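/- Proposition. Let $\mathbb K$ be $\mathbb R$ or $\mathbb C$; all Banach spaces are over $\mathbb K$ and all operators are bounded and linear. **Trees.** Finite sequences are ordered by initial segments; $\mathrm{MAX}(T)$ is the set of maximal members of a set $T$ of non-empty finite sequences, $\frown$ is concatenation, and $\zeta+(\zeta_i)_{i=1}^k=(\zeta+\zeta_i)_{i=1}^k$ for ordinals. For every ordinal $\xi$ and $n\in\mathbb N=\{1,2,\dots\}$ define a set $\Gamma_{\xi,n}$ of finite sequences of ordinals and $\mathbb P_{\xi,n}:\Gamma_{\xi,n}\to[0,1]$ recursively by - $\Gamma_{0,1}=\{(0)\}$, $\mathbb P_{0,1}((0))=1$; - $\Gamma_{\xi,n+1}=\{\omega^\xi n+s: s\in\Gamma_{\xi,1}\}\cup\{(\omega^\xi n+t)\frown u: t\in \mathrm{MAX}(\Gamma_{\xi,1}),\,u\in\Gamma_{\xi,n}\}$, $\mathbb P_{\xi,n+1}(\omega^\xi n+s)=\mathbb P_{\xi,1}(s)$, $\mathbb P_{\xi,n+1}((\omega^\xi n+t)\frown u)=\mathbb P_{\xi,n}(u)$; - $\Gamma_{\xi+1,1}=\bigcup_{n\ge1}\Gamma_{\xi,n}$,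 $\mathbb P_{\xi+1,1}|_{\Gamma_{\xi,n}}=n^{-1}\mathbb P_{\xi,n}$; - for limit $\xi$, $\Gamma_{\xi,1}=\bigcup_{\zeta<\xi}(\omega^\zeta+\Gamma_{\zeta+1,1})$, $\mathbb P_{\xi,1}(\omega^\zeta+t)=\mathbb P_{\zeta+1,1}(t)$ (all these unions are disjoint). For $1\le i\le n$ the level $\Lambda_{\xi,n,i}$ is the set of all $(\omega^\xi(n-1)+t_1)\frown\dots\frown(\omega^\xi(n-i)+t_i)$ with $t_i\in\Gamma_{\xi,1}$ and $t_j\in\mathrm{MAX}(\Gamma_{\xi,1})$ for $j<i$. **Weakly null collections.** For a Banach space $X$ let $D_X$ be the set of weakly open sets containing $0$, directed by reverse inclusion. Let $\Gamma_{\xi,n}.D_X$ be the set of all sequences $(\zeta_i,u_i)_{i=1}^k$ with $(\zeta_i)_{i=1}^k\in\Gamma_{\xi,n}$ and $u_i\in D_X$; levels and $\mathbb P_{\xi,n}$ are carried over to it by forgetting the $u_i$. Let $\mathcal B^X_{\xi,n}$ be the set of all collections $(x_t)_{t\in\Gamma_{\xi,n}.D_X}$ in the closed unit ball of $X$ such that,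 for all $t\in\{\varnothing\}\cup\Gamma_{\xi,n}.D_X$ and all $\zeta$ for which the sequences $t\frown(\zeta,u)$, $u\in D_X$, belong to $\Gamma_{\xi,n}.D_X$, the net $(x_{t\frown(\zeta,u)})_{u\in D_X}$ is weakly null. **The quantities $\theta_{\xi,n}$.** For an operator $A:X\to Y$ between Banach spaces and a finitely supported scalar sequence $(a_i)_{i\ge1}$ let $$\Bigl\|\sum_i a_ie_i\Bigr\|_{\xi,A}=\sup\Bigl\{\inf_{t\in \mathrm{MAX}(\Gamma_{\xi,n}.D_X)}\Bigl\|A\sum_{i=1}^n a_i\sum_{\Lambda_{\xi,n,i}.D_X\ni s\le t}\mathbb P_{\xi,n}(s)x_s\Bigr\| : n\in\mathbb N,\ (x_t)\in\mathcal B^X_{\xi,n}\Bigr\},$$ and $\theta_{\xi,n}(A)=\bigl\|n^{-1}\sum_{i=1}^n e_i\bigr\|_{\xi,A}$. **Claim.** Let $\xi$ be an ordinal, $1<p\le\infty$ and $1/p+1/q=1$. Let $\mathfrak N_{\xi,p}$ be the class of all operators $A$ between Banach spaces with $\sup_{n} n^{1/q}\theta_{\xi,n}(A)<\infty$, and put $\mathfrak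 n_{\xi,p}(A)=\|A\|+\sup_n n^{1/q}\theta_{\xi,n}(A)$. Then $(\mathfrak N_{\xi,p},\mathfrak n_{\xi,p})$ is a Banach ideal, that is, for all Banach spaces $W,X,Y,Z$: 1. $\mathfrak N_{\xi,p}(X,Y)=\mathfrak N_{\xi,p}\cap\mathfrak L(X,Y)$ is a linear subspace of the space $\mathfrak L(X,Y)$ of operators that contains the operators $x^*\otimes y: x\mapsto x^*(x)y$ for $x^*\in X^*$, $y\in Y$; and $BAC\in\mathfrak N_{\xi,p}$ whenever $C\in\mathfrak L(W,X)$, $A\in\mathfrak N_{\xi,p}(X,Y)$, $B\in\mathfrak L(Y,Z)$; 2. $\mathfrak n_{\xi,p}$ is a norm on $\mathfrak N_{\xi,p}(X,Y)$, $\mathfrak n_{\xi,p}(x^*\otimes y)=\|x^*\|\,\|y\|$, and $\mathfrak n_{\xi,p}(BAC)\le\|B\|\,\mathfrak n_{\xi,p}(A)\,\|C\|$ for $A,B,C$ as in 1; 3. $\mathfrak N_{\xi,p}(X,Y)$ is complete with respect to $\mathfrak n_{\xi,p}$. -/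

import Mathlib

open scoped ENNReal Ordinal Topology

universe u v w

noncomputable section

namespace SzlenkIdeal

/-! ### Trees of finite sequences -/

/-- The members of a set of finite sequences that are maximal for the initial segment order. -/
def maxNodes {Λ : Type*} (T : Set (List Λ)) : Set (List Λ) :=
  {t | t ∈ T ∧ ∀ s ∈ T, t <+: s → s = t}

/-- The sequence `ζ + t = (ζ + ζ₁, …, ζ + ζₖ)`. -/
def shift (ζ : Ordinal.{v}) (t : List Ordinal.{v}) : List Ordinal.{v} :=
  t.map fun η => ζ + η

/-- The tree `T.D` of all sequences `(ζᵢ, uᵢ)ᵢ` with `(ζᵢ)ᵢ ∈ T` and `uᵢ ∈ D`. -/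
def treeProd {Λ : Type*} (T : Set (List Λ)) (D : Type*) : Set (List (Λ × D)) :=
  {t | t.map Prod.fst ∈ T}

/-! ### The trees `Γ_{ξ,n}`, their weights `ℙ_{ξ,n}` and their levels

A tree with a weight function is handled through the graph of the weight function, a set of pairs
`(t, r)` where `t` is a member of the tree and `r` is its weight. -/

/-- Given `w = ω ^ ξ` and the graph `G` of `ℙ_{ξ,1}`, the graphs of `ℙ_{ξ,n}` for `n = 0, 1, 2, …`,
where `Γ_{ξ,0}` is empty. For `n = 0` the successor clause returns `G` itself. -/
def stackGraph (w : Ordinal.{v}) (G : Set (List Ordinal.{v} × ℝ)) :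
    ℕ → Set (List Ordinal.{v} × ℝ)
  | 0 => ∅
  | n + 1 =>
      {p | ∃ s r, (s, r) ∈ G ∧ p = (shift (w * n) s, r)} ∪
      {p | ∃ t ∈ maxNodes (Prod.fst '' G), ∃ u r, (u, r) ∈ stackGraph w G n ∧
        p = (shift (w * n) t ++ u, r)}

/-- The graph of `ℙ_{ξ,1} : Γ_{ξ,1} → [0,1]`. -/
def graphOne (ξ : Ordinal.{v}) : Set (List Ordinal.{v} × ℝ) :=
  Ordinal.limitRecOn ξ
    {([0], 1)}
    (fun ζ G => {p | ∃ n : ℕ, 1 ≤ n ∧ ∃ t r, (t, r) ∈ stackGraph (ω ^ ζ) G n ∧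
      p = (t, (n : ℝ)⁻¹ * r)})
    (fun ξ hξ ih => {p | ∃ ζ, ∃ h : ζ < ξ, ∃ t r,
      (t, r) ∈ ih (ζ + 1) (hξ.add_one_lt h) ∧ p = (shift (ω ^ ζ) t, r)})

/-- The graph of `ℙ_{ξ,n} : Γ_{ξ,n} → [0,1]`, for `n ≥ 1`. -/
def graph (ξ : Ordinal.{v}) (n : ℕ) : Set (List Ordinal.{v} × ℝ) :=
  stackGraph (ω ^ ξ) (graphOne ξ) n

/-- The tree `Γ_{ξ,n}`, for `n ≥ 1`. -/
def Gam (ξ : Ordinal.{v}) (n : ℕ) : Set (List Ordinal.{v}) :=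
  Prod.fst '' graph ξ n

open Classical in
/-- The weight `ℙ_{ξ,n}(t)` of a member `t` of `Γ_{ξ,n}`. It is uniquely determined, see
`weight_eq`. -/
def weight (ξ : Ordinal.{v}) (n : ℕ) (t : List Ordinal.{v}) : ℝ :=
  if h : ∃ r, (t, r) ∈ graph ξ n then h.choose else 0

/-- The levels of `Γ_{ξ,n}`, counted from zero: for `i < n`, `level ξ n i` is `Λ_{ξ,n,i+1}`, the
set of all `t = (ω^ξ (n-1) + t₁) ⌢ … ⌢ (ω^ξ (n-i-1) + tᵢ₊₁)` where `tᵢ₊₁ ∈ Γ_{ξ,1}` and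
`t₁, …, tᵢ` are maximal members of `Γ_{ξ,1}`. -/
def level (ξ : Ordinal.{v}) : ℕ → ℕ → Set (List Ordinal.{v})
  | 0, _ => ∅
  | n + 1, 0 => {p | ∃ s ∈ Gam ξ 1, p = shift (ω ^ ξ * n) s}
  | n + 1, i + 1 => {p | ∃ t ∈ maxNodes (Gam ξ 1), ∃ u ∈ level ξ n i,
      p = shift (ω ^ ξ * n) t ++ u}

/-! ### The recursive description of the trees, and uniqueness of the weights -/

theorem shift_zero (t : List Ordinal.{v}) : shift 0 t = t := by
  simp [shift]

theorem shift_injective (ζ : Ordinal.{v}) : Function.Injective (shift ζ) :=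
  List.map_injective_iff.2 fun _ _ h => by simpa using h

theorem graph_one (ξ : Ordinal.{v}) : graph ξ 1 = graphOne ξ := by
  ext ⟨t, r⟩
  simp [graph, stackGraph, shift_zero]

theorem graph_zero_one : graph (0 : Ordinal.{v}) 1 = {([0], 1)} := by
  rw [graph_one, graphOne, Ordinal.limitRecOn_zero]

theorem graph_succ_one (ξ : Ordinal.{v}) :
    graph (ξ + 1) 1 = {p | ∃ n : ℕ, 1 ≤ n ∧ ∃ t r, (t, r) ∈ graph ξ n ∧
      p = (t, (n : ℝ)⁻¹ * r)} := by
  rw [graph_one, graphOne, Ordinal.limitRecOn_add_one]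
  rfl

theorem graph_limit_one (ξ : Ordinal.{v}) (hξ : Order.IsSuccLimit ξ) :
    graph ξ 1 = {p | ∃ ζ < ξ, ∃ t r, (t, r) ∈ graph (ζ + 1) 1 ∧ p = (shift (ω ^ ζ) t, r)} := by
  rw [graph_one, graphOne, Ordinal.limitRecOn_limit _ _ _ _ hξ]
  simp only [graph_one, exists_prop]
  rfl

theorem graph_add_one (ξ : Ordinal.{v}) (n : ℕ) :
    graph ξ (n + 1) = {p | ∃ s r, (s, r) ∈ graph ξ 1 ∧ p = (shift (ω ^ ξ * n) s, r)} ∪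
      {p | ∃ t ∈ maxNodes (Gam ξ 1), ∃ u r, (u, r) ∈ graph ξ n ∧
        p = (shift (ω ^ ξ * n) t ++ u, r)} := by
  simp only [Gam, graph_one]
  rfl

theorem Gam_zero_one : Gam (0 : Ordinal.{v}) 1 = {[0]} := by
  simp [Gam, graph_zero_one]

theorem Gam_succ_one (ξ : Ordinal.{v}) : Gam (ξ + 1) 1 = ⋃ n ≥ 1, Gam ξ n := by
  ext t
  simp [Gam, graph_succ_one]

theorem Gam_limit_one (ξ : Ordinal.{v}) (hξ : Order.IsSuccLimit ξ) :
    Gam ξ 1 = ⋃ ζ < ξ, shift (ω ^ ζ) '' Gam (ζ + 1) 1 := by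
  ext t
  simp only [Gam, graph_limit_one ξ hξ]
  simp
  grind

theorem Gam_add_one (ξ : Ordinal.{v}) (n : ℕ) :
    Gam ξ (n + 1) = {p | ∃ s ∈ Gam ξ 1, p = shift (ω ^ ξ * n) s} ∪
      {p | ∃ t ∈ maxNodes (Gam ξ 1), ∃ u ∈ Gam ξ n, p = shift (ω ^ ξ * n) t ++ u} := by
  ext p
  rw [Gam, graph_add_one]
  simp only [Gam]
  simp
  grind

/-- Members of `Γ_{ξ,1}` are nonempty with entries below `ω ^ ξ`, and have unique weights. -/
def Good (ξ : Ordinal.{v}) : Prop :=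
  (∀ t ∈ Gam ξ 1, t ≠ [] ∧ ∀ b ∈ t, b < ω ^ ξ) ∧
    ∀ t r r', (t, r) ∈ graph ξ 1 → (t, r') ∈ graph ξ 1 → r = r'

theorem mem_Gam_of_mem_graph {ξ : Ordinal.{v}} {n : ℕ} {t : List Ordinal.{v}} {r : ℝ}
    (h : (t, r) ∈ graph ξ n) : t ∈ Gam ξ n := ⟨_, h, rfl⟩

theorem shift_ge {ζ : Ordinal.{v}} {t : List Ordinal.{v}} {b : Ordinal.{v}} (h : b ∈ shift ζ t) :
    ζ ≤ b := by
  simp only [shift, List.mem_map] at h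
  obtain ⟨c, -, rfl⟩ := h
  exact le_self_add

theorem Good.bound {ξ : Ordinal.{v}} (h : Good ξ) (n : ℕ) :
    ∀ t ∈ Gam ξ (n + 1), (∃ a l, t = a :: l ∧ ω ^ ξ * n ≤ a) ∧
      ∀ b ∈ t, b < ω ^ ξ * (n + 1 : ℕ) := by
  have key : ∀ (m : ℕ), ∀ s ∈ Gam ξ 1, (∃ a l, shift (ω ^ ξ * m) s = a :: l ∧ ω ^ ξ * m ≤ a) ∧
      ∀ b ∈ shift (ω ^ ξ * m) s, b < ω ^ ξ * (m + 1 : ℕ) := by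
    intro m s hs
    obtain ⟨h1, h2⟩ := h.1 s hs
    constructor
    · cases s with
      | nil => exact absurd rfl h1
      | cons a l => exact ⟨_, _, rfl, le_self_add⟩
    · intro b hb
      simp only [shift, List.mem_map] at hb
      obtain ⟨c, hc, rfl⟩ := hb
      push_cast
      rw [mul_add_one]
      gcongr
      exact h2 c hc
  induction n with
  | zero =>
    intro t ht
    have := key 0 t ht
    simpa [shift_zero] using this
  | succ n ih =>
    intro t ht
    rw [Gam_add_one] at ht
    rcases ht with ⟨s, hs, rfl⟩ | ⟨s, hs, u, hu, rfl⟩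
    · exact key _ s hs
    · obtain ⟨⟨a, l, h1, h2⟩, h3⟩ := key (n + 1) s hs.1
      obtain ⟨-, h4⟩ := ih u hu
      refine ⟨⟨a, l ++ u, by rw [h1]; rfl, h2⟩, fun b hb => ?_⟩
      rcases List.mem_append.1 hb with hb | hb
      · exact h3 b hb
      · refine (h4 b hb).trans_le ?_
        gcongr
        omega

theorem split_unique {c : Ordinal.{v}} {s s' u u' : List Ordinal.{v}}
    (hs : ∀ b ∈ s, c ≤ b) (hs' : ∀ b ∈ s', c ≤ b) (hu : ∀ b ∈ u, b < c) (hu' : ∀ b ∈ u', b < c)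
    (h : s ++ u = s' ++ u') : s = s' ∧ u = u' := by
  induction s generalizing s' with
  | nil =>
    cases s' with
    | nil => simpa using h
    | cons a l =>
      have := hu a (by simp at h; simp [h])
      exact absurd (hs' a (by simp)) (not_le.2 this)
  | cons a l ih =>
    cases s' with
    | nil =>
      have := hu' a (by simp at h; simp [← h])
      exact absurd (hs a (by simp)) (not_le.2 this)
    | cons a' l' =>
      simp only [List.cons_append, List.cons.injEq] at h
      obtain ⟨h1, h2⟩ := ih (fun b hb => hs b (by simp [hb])) (fun b hb => hs' b (by simp [hb])) h.2
      exact ⟨by rw [h.1, h1], h2⟩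

theorem Good.unique {ξ : Ordinal.{v}} (h : Good ξ) (n : ℕ) :
    ∀ t r r', (t, r) ∈ graph ξ n → (t, r') ∈ graph ξ n → r = r' := by
  induction n with
  | zero => intro t r r' h1; simp [graph, stackGraph] at h1
  | succ n ih =>
    have hb : ∀ u ∈ Gam ξ n, u ≠ [] ∧ ∀ b ∈ u, b < ω ^ ξ * n := by
      intro u hu
      cases n with
      | zero => simp [Gam, graph, stackGraph] at hu
      | succ m =>
        obtain ⟨⟨a, l, h1, -⟩, h2⟩ := h.bound m u hu
        exact ⟨by simp [h1], h2⟩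
    intro t r r' h1 h2
    rw [graph_add_one] at h1 h2
    rcases h1 with ⟨s, x, hs, e⟩ | ⟨s, hs, u, x, hu, e⟩ <;>
    rcases h2 with ⟨s', x', hs', e'⟩ | ⟨s', hs', u', x', hu', e'⟩ <;>
    simp only [Prod.mk.injEq] at e e' <;> obtain ⟨e, rfl⟩ := e <;> obtain ⟨e', rfl⟩ := e'
    · rw [e] at e'
      rw [shift_injective _ e'] at hs
      exact h.2 _ _ _ hs hs'
    · obtain ⟨h3, h4⟩ := hb u' (mem_Gam_of_mem_graph hu')
      have := split_unique (u := []) (fun b => shift_ge) (fun b => shift_ge) (by simp) h4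
        (by simpa using e.symm.trans e')
      exact absurd this.2.symm h3
    · obtain ⟨h3, h4⟩ := hb u (mem_Gam_of_mem_graph hu)
      have := split_unique (u := []) (fun b => shift_ge) (fun b => shift_ge) (by simp) h4
        (by simpa using e'.symm.trans e)
      exact absurd this.2.symm h3
    · have := split_unique (fun b => shift_ge) (fun b => shift_ge)
        (hb u (mem_Gam_of_mem_graph hu)).2 (hb u' (mem_Gam_of_mem_graph hu')).2 (e.symm.trans e')
      rw [this.2] at hu
      exact ih _ _ _ hu hu'

theorem good (ξ : Ordinal.{v}) : Good ξ := by
  induction ξ using Ordinal.limitRecOn with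
  | zero =>
    constructor
    · intro t ht
      rw [Gam_zero_one] at ht
      obtain rfl : t = [0] := ht
      simp
    · intro t r r' h h'
      rw [graph_zero_one] at h h'
      simp at h h'
      rw [h.2, h'.2]
  | add_one ξ ih =>
    constructor
    · intro t ht
      rw [Gam_succ_one] at ht
      simp only [Set.mem_iUnion] at ht
      obtain ⟨n, hn, ht⟩ := ht
      obtain ⟨m, rfl⟩ := Nat.exists_eq_add_of_le' hn
      obtain ⟨⟨a, l, h1, -⟩, h2⟩ := ih.bound m t ht
      refine ⟨by simp [h1], fun b hb => (h2 b hb).trans ?_⟩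
      rw [Ordinal.opow_add, Ordinal.opow_one]
      gcongr
      · exact Ordinal.opow_pos _ Ordinal.omega0_pos
      · exact Ordinal.natCast_lt_omega0 _
    · intro t r r' h h'
      rw [graph_succ_one] at h h'
      obtain ⟨n, hn, s, x, hs, e⟩ := h
      obtain ⟨n', hn', s', x', hs', e'⟩ := h'
      simp only [Prod.mk.injEq] at e e'
      obtain ⟨rfl, rfl⟩ := e
      obtain ⟨rfl, rfl⟩ := e'
      obtain ⟨m, rfl⟩ := Nat.exists_eq_add_of_le' hn
      obtain ⟨m', rfl⟩ := Nat.exists_eq_add_of_le' hn'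
      obtain ⟨⟨a, l, rfl, h1⟩, h2⟩ := ih.bound m t (mem_Gam_of_mem_graph hs)
      obtain ⟨⟨a', l', e, h1'⟩, h2'⟩ := ih.bound m' _ (mem_Gam_of_mem_graph hs')
      obtain ⟨rfl, rfl⟩ := List.cons.inj e
      have e1 := lt_of_mul_lt_mul_left' (h1.trans_lt (h2' a (by simp)))
      have e2 := lt_of_mul_lt_mul_left' (h1'.trans_lt (h2 a (by simp)))
      have : m = m' := by
        have e1 : m < m' + 1 := by exact_mod_cast e1
        have e2 : m' < m + 1 := by exact_mod_cast e2
        omega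
      subst this
      rw [ih.unique _ _ _ _ hs hs']
  | limit ξ hξ ih =>
    have hb : ∀ ζ < ξ, ∀ t ∈ Gam (ζ + 1) 1, ∃ a l, shift (ω ^ ζ) t = a :: l ∧ ω ^ ζ ≤ a ∧
        ∀ b ∈ shift (ω ^ ζ) t, b < ω ^ (ζ + 1) := by
      intro ζ hζ t ht
      obtain ⟨h1, h2⟩ := (ih (ζ + 1) (hξ.add_one_lt hζ)).1 t ht
      cases t with
      | nil => exact absurd rfl h1
      | cons a l =>
        refine ⟨_, _, rfl, le_self_add, fun b hb => ?_⟩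
        simp only [shift, List.mem_map] at hb
        obtain ⟨c, hc, rfl⟩ := hb
        refine Ordinal.isPrincipal_add_omega0_opow _ ?_ (h2 c hc)
        exact (Ordinal.opow_lt_opow_iff_right Ordinal.one_lt_omega0).2 (Order.lt_add_one_iff.2 le_rfl)
    constructor
    · intro t ht
      rw [Gam_limit_one ξ hξ] at ht
      simp only [Set.mem_iUnion] at ht
      obtain ⟨ζ, hζ, s, hs, rfl⟩ := ht
      obtain ⟨a, l, h1, -, h2⟩ := hb ζ hζ s hs
      refine ⟨by simp [h1], fun b hb => (h2 b hb).trans_le ?_⟩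
      exact Ordinal.opow_le_opow_right Ordinal.omega0_pos (hξ.add_one_lt hζ).le
    · intro t r r' h h'
      rw [graph_limit_one ξ hξ] at h h'
      obtain ⟨ζ, hζ, s, x, hs, e⟩ := h
      obtain ⟨ζ', hζ', s', x', hs', e'⟩ := h'
      simp only [Prod.mk.injEq] at e e'
      obtain ⟨rfl, rfl⟩ := e
      obtain ⟨e', rfl⟩ := e'
      obtain ⟨a, l, h1, h2, h3⟩ := hb ζ hζ s (mem_Gam_of_mem_graph hs)
      obtain ⟨a', l', h1', h2', h3'⟩ := hb ζ' hζ' s' (mem_Gam_of_mem_graph hs')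
      obtain ⟨rfl, rfl⟩ := List.cons.inj (h1.symm.trans (e'.trans h1'))
      have e1 := (Ordinal.opow_lt_opow_iff_right Ordinal.one_lt_omega0).1
        (h2.trans_lt (h3' a (by simp [h1'])))
      have e2 := (Ordinal.opow_lt_opow_iff_right Ordinal.one_lt_omega0).1
        (h2'.trans_lt (h3 a (by simp [h1])))
      obtain rfl : ζ = ζ' := le_antisymm (Order.lt_add_one_iff.1 e1) (Order.lt_add_one_iff.1 e2)
      rw [shift_injective _ e'] at hs
      exact (ih (ζ + 1) (hξ.add_one_lt hζ)).2 _ _ _ hs hs'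

/-- `ℙ_{ξ,n}(t)` is the only number that is paired with `t` in the graph. -/
theorem weight_eq {ξ : Ordinal.{v}} {n : ℕ} {t : List Ordinal.{v}} {r : ℝ}
    (h : (t, r) ∈ graph ξ n) : weight ξ n t = r := by
  have h' : ∃ r, (t, r) ∈ graph ξ n := ⟨r, h⟩
  rw [weight, dif_pos h']
  exact (good ξ).unique n _ _ _ h'.choose_spec h

/-! ### Weakly null collections and the quantities `θ_{ξ,n}` -/

section Operators

variable (𝕜 : Type w) [RCLike 𝕜]

/-- The directed set `D_X` of all weakly open subsets of `X` that contain `0`, directed by reverse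
inclusion. -/
abbrev WeakNhds (X : Type u) [NormedAddCommGroup X] [NormedSpace 𝕜 X] : Type u :=
  (TopologicalSpace.OpenNhdsOf (0 : WeakSpace 𝕜 X))ᵒᵈ

/-- The collection `(x_t)_{t ∈ T.D}` is weakly null: for each `t` (empty or in `T.D`) and `ζ` such
that the sequences `t ⌢ (ζ, u)` belong to `T.D`, the net `(x_{t ⌢ (ζ, u)})_{u ∈ D}` is weakly null.
The values of `x` outside `T.D` play no role. -/
def IsWeaklyNull {Λ : Type*} (T : Set (List Λ)) {D : Type*} [Preorder D]
    {X : Type u} [NormedAddCommGroup X] [NormedSpace 𝕜 X] (x : List (Λ × D) → X) : Prop :=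
  ∀ (t : List (Λ × D)) (ζ : Λ), t.map Prod.fst ++ [ζ] ∈ T →
    Filter.Tendsto (fun u : D => toWeakSpace 𝕜 X (x (t ++ [(ζ, u)]))) Filter.atTop (𝓝 0)

/-- The set `𝓑^X_{ξ,n}` of all weakly null collections `(x_t)_{t ∈ Γ_{ξ,n}.D_X}` in the closed unit
ball of `X`. -/
def nullCollections (ξ : Ordinal.{v}) (n : ℕ) (X : Type u) [NormedAddCommGroup X]
    [NormedSpace 𝕜 X] : Set (List (Ordinal.{v} × WeakNhds 𝕜 X) → X) :=
  {x | IsWeaklyNull 𝕜 (Gam ξ n) x ∧ ∀ t ∈ treeProd (Gam ξ n) (WeakNhds 𝕜 X), ‖x t‖ ≤ 1}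

variable {𝕜}
variable {X Y : Type u} [NormedAddCommGroup X] [NormedSpace 𝕜 X]
  [NormedAddCommGroup Y] [NormedSpace 𝕜 Y]

open Classical in
/-- The vector `∑ᵢ aᵢ ∑ ℙ_{ξ,n}(s) x_s`, where `i` runs through the `n` levels and the inner sum is
over all nonempty initial segments `s` of `t` in the `i`-th level of `Γ_{ξ,n}.D_X`. -/
def branchSum (ξ : Ordinal.{v}) (n : ℕ) (a : ℕ →₀ 𝕜)
    (x : List (Ordinal.{v} × WeakNhds 𝕜 X) → X) (t : List (Ordinal.{v} × WeakNhds 𝕜 X)) : X :=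
  ∑ i ∈ Finset.range n, a i •
    ∑ k ∈ (Finset.Icc 1 t.length).filter (fun k => (t.take k).map Prod.fst ∈ level ξ n i),
      ((weight ξ n ((t.take k).map Prod.fst) : ℝ) : 𝕜) • x (t.take k)

/-- The seminorm `‖·‖_{ξ,A}` on `c₀₀`, the coordinates being counted from zero. -/
def seminormOf (ξ : Ordinal.{v}) (A : X →L[𝕜] Y) (a : ℕ →₀ 𝕜) : ℝ≥0∞ :=
  ⨆ n : ℕ, ⨆ _ : 1 ≤ n, ⨆ x ∈ nullCollections 𝕜 ξ n X,
    ⨅ t ∈ maxNodes (treeProd (Gam ξ n) (WeakNhds 𝕜 X)), ‖A (branchSum ξ n a x t)‖ₑ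

/-- `θ_{ξ,n}(A) = ‖n⁻¹ (e₁ + ⋯ + eₙ)‖_{ξ,A}`. -/
def theta (ξ : Ordinal.{v}) (n : ℕ) (A : X →L[𝕜] Y) : ℝ≥0∞ :=
  seminormOf ξ A ((n : 𝕜)⁻¹ • ∑ i ∈ Finset.range n, Finsupp.single i 1)

/-- `N_{ξ,p}(A) = sup_{n ≥ 1} n^{1/q} θ_{ξ,n}(A)`, where `1/p + 1/q = 1`. -/
def supN (ξ : Ordinal.{v}) (p : ℝ≥0∞) (A : X →L[𝕜] Y) : ℝ≥0∞ :=
  ⨆ n : ℕ, ⨆ _ : 1 ≤ n, (n : ℝ≥0∞) ^ (p.conjExponent⁻¹).toReal * theta ξ n A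

variable (𝕜) in
/-- The component `𝔑_{ξ,p}(X, Y)` of the class `𝔑_{ξ,p}`. -/
def classN (ξ : Ordinal.{v}) (p : ℝ≥0∞) (X Y : Type u) [NormedAddCommGroup X] [NormedSpace 𝕜 X]
    [NormedAddCommGroup Y] [NormedSpace 𝕜 Y] : Set (X →L[𝕜] Y) :=
  {A | supN ξ p A < ∞}

/-- `𝔫_{ξ,p}(A) = ‖A‖ + N_{ξ,p}(A)`, for `A ∈ 𝔑_{ξ,p}`. -/
def normN (ξ : Ordinal.{v}) (p : ℝ≥0∞) (A : X →L[𝕜] Y) : ℝ :=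
  ‖A‖ + (supN ξ p A).toReal

end Operators

/-! ### Banach ideals -/

/-- A class of operators between Banach spaces, given by its components. -/
abbrev OperatorClass (𝕜 : Type w) [RCLike 𝕜] :=
  ∀ (X Y : Type u) [NormedAddCommGroup X] [NormedSpace 𝕜 X] [CompleteSpace X]
    [NormedAddCommGroup Y] [NormedSpace 𝕜 Y] [CompleteSpace Y], Set (X →L[𝕜] Y)

/-- A real-valued function of operators between Banach spaces. -/
abbrev OperatorFunction (𝕜 : Type w) [RCLike 𝕜] :=
  ∀ (X Y : Type u) [NormedAddCommGroup X] [NormedSpace 𝕜 X] [CompleteSpace X]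
    [NormedAddCommGroup Y] [NormedSpace 𝕜 Y] [CompleteSpace Y], (X →L[𝕜] Y) → ℝ

/-- Operator ideals: each component is a linear subspace that contains the operators of rank one,
and the class is stable under composition with bounded operators on both sides. -/
structure IsOperatorIdeal {𝕜 : Type w} [RCLike 𝕜] (J : OperatorClass.{u} 𝕜) : Prop where
  rank_one_mem : ∀ (X Y : Type u) [NormedAddCommGroup X] [NormedSpace 𝕜 X] [CompleteSpace X]
    [NormedAddCommGroup Y] [NormedSpace 𝕜 Y] [CompleteSpace Y] (f : StrongDual 𝕜 X) (y : Y),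
    f.smulRight y ∈ J X Y
  add_mem : ∀ (X Y : Type u) [NormedAddCommGroup X] [NormedSpace 𝕜 X] [CompleteSpace X]
    [NormedAddCommGroup Y] [NormedSpace 𝕜 Y] [CompleteSpace Y] (A B : X →L[𝕜] Y),
    A ∈ J X Y → B ∈ J X Y → A + B ∈ J X Y
  smul_mem : ∀ (X Y : Type u) [NormedAddCommGroup X] [NormedSpace 𝕜 X] [CompleteSpace X]
    [NormedAddCommGroup Y] [NormedSpace 𝕜 Y] [CompleteSpace Y] (c : 𝕜) (A : X →L[𝕜] Y),
    A ∈ J X Y → c • A ∈ J X Y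
  comp_mem : ∀ (W X Y Z : Type u) [NormedAddCommGroup W] [NormedSpace 𝕜 W] [CompleteSpace W]
    [NormedAddCommGroup X] [NormedSpace 𝕜 X] [CompleteSpace X]
    [NormedAddCommGroup Y] [NormedSpace 𝕜 Y] [CompleteSpace Y]
    [NormedAddCommGroup Z] [NormedSpace 𝕜 Z] [CompleteSpace Z]
    (C : W →L[𝕜] X) (A : X →L[𝕜] Y) (B : Y →L[𝕜] Z), A ∈ J X Y → B ∘L A ∘L C ∈ J W Z

/-- Ideal norms on a class of operators. -/
structure IsIdealNorm {𝕜 : Type w} [RCLike 𝕜] (J : OperatorClass.{u} 𝕜)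
    (ι : OperatorFunction.{u} 𝕜) : Prop where
  nonneg : ∀ (X Y : Type u) [NormedAddCommGroup X] [NormedSpace 𝕜 X] [CompleteSpace X]
    [NormedAddCommGroup Y] [NormedSpace 𝕜 Y] [CompleteSpace Y] (A : X →L[𝕜] Y),
    A ∈ J X Y → 0 ≤ ι X Y A
  eq_zero_iff : ∀ (X Y : Type u) [NormedAddCommGroup X] [NormedSpace 𝕜 X] [CompleteSpace X]
    [NormedAddCommGroup Y] [NormedSpace 𝕜 Y] [CompleteSpace Y] (A : X →L[𝕜] Y),
    A ∈ J X Y → (ι X Y A = 0 ↔ A = 0)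
  add_le : ∀ (X Y : Type u) [NormedAddCommGroup X] [NormedSpace 𝕜 X] [CompleteSpace X]
    [NormedAddCommGroup Y] [NormedSpace 𝕜 Y] [CompleteSpace Y] (A B : X →L[𝕜] Y),
    A ∈ J X Y → B ∈ J X Y → ι X Y (A + B) ≤ ι X Y A + ι X Y B
  smul_eq : ∀ (X Y : Type u) [NormedAddCommGroup X] [NormedSpace 𝕜 X] [CompleteSpace X]
    [NormedAddCommGroup Y] [NormedSpace 𝕜 Y] [CompleteSpace Y] (c : 𝕜) (A : X →L[𝕜] Y),
    A ∈ J X Y → ι X Y (c • A) = ‖c‖ * ι X Y A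
  rank_one : ∀ (X Y : Type u) [NormedAddCommGroup X] [NormedSpace 𝕜 X] [CompleteSpace X]
    [NormedAddCommGroup Y] [NormedSpace 𝕜 Y] [CompleteSpace Y] (f : StrongDual 𝕜 X) (y : Y),
    ι X Y (f.smulRight y) = ‖f‖ * ‖y‖
  comp_le : ∀ (W X Y Z : Type u) [NormedAddCommGroup W] [NormedSpace 𝕜 W] [CompleteSpace W]
    [NormedAddCommGroup X] [NormedSpace 𝕜 X] [CompleteSpace X]
    [NormedAddCommGroup Y] [NormedSpace 𝕜 Y] [CompleteSpace Y]
    [NormedAddCommGroup Z] [NormedSpace 𝕜 Z] [CompleteSpace Z]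
    (C : W →L[𝕜] X) (A : X →L[𝕜] Y) (B : Y →L[𝕜] Z), A ∈ J X Y →
    ι W Z (B ∘L A ∘L C) ≤ ‖B‖ * ι X Y A * ‖C‖

/-- Banach ideals: operator ideals with an ideal norm for which all components are complete. -/
structure IsBanachIdeal {𝕜 : Type w} [RCLike 𝕜] (J : OperatorClass.{u} 𝕜)
    (ι : OperatorFunction.{u} 𝕜) : Prop where
  ideal : IsOperatorIdeal J
  norm : IsIdealNorm J ι
  complete : ∀ (X Y : Type u) [NormedAddCommGroup X] [NormedSpace 𝕜 X] [CompleteSpace X]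
    [NormedAddCommGroup Y] [NormedSpace 𝕜 Y] [CompleteSpace Y] (A : ℕ → X →L[𝕜] Y),
    (∀ n, A n ∈ J X Y) →
    (∀ ε : ℝ, 0 < ε → ∃ N, ∀ m ≥ N, ∀ n ≥ N, ι X Y (A m - A n) < ε) →
    ∃ B ∈ J X Y, Filter.Tendsto (fun n => ι X Y (A n - B)) Filter.atTop (𝓝 0)

end SzlenkIdeal

end

/-!
The infimum over branches and the supremum over collections are the two sides of a game along
`Γ_{ξ,n}`. In each round the first player chooses the next letter and a weak neighbourhood of `0`,
the second player a vector of the unit ball in that neighbourhood, which is added to the current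
vector with its coefficient. Weakly null collections are strategies of the second player, so
`‖a‖_{ξ,A} < c` gives the first player a strategy to end in `{x | ‖A x‖ < c}`.

Let `F_ξ(a) S` be the attractor of `S` in the game on `Γ_{ξ,1}` with coefficients `a ℙ_{ξ,1}`. The
recursion for the trees becomes `F_{ξ+1}(a) = ⋃ₙ F_ξ(a/n)ⁿ`, and `F_ξ = ⋃_{ζ<ξ} F_{ζ+1}` at limits.
Averages of weakly null vectors are weakly null, so one round with coefficient `M a` can be replaced
by `M` rounds with coefficient `a`; by induction `F_ξ(M a) S ⊆ F_ξ(a)^M S`. Hence strategies that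
use `N` and `M` blocks can both be refined to `M N` blocks and then played simultaneously:
attractors commute with intersections. Applied to `{x | ‖A x‖ < c}` and `{x | ‖B x‖ < d}`, this is
the triangle inequality `‖a‖_{ξ,A+B} ≤ ‖a‖_{ξ,A} + ‖a‖_{ξ,B}`.

With it `A ↦ ‖a‖_{ξ,A}` is a norm continuous ideal seminorm which vanishes on operators of rank one,
and completeness follows from the lower semicontinuity of weighted suprema of such seminorms.
-/

noncomputable section

namespace SzlenkIdeal

/-! ### Subtrees and concatenations of trees -/

section Trees

variable {Λ : Type*}

/-- The tree of all continuations of the letter `ζ` in `T`. It contains the empty sequence when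
`[ζ] ∈ T`. -/
def subtree (T : Set (List Λ)) (ζ : Λ) : Set (List Λ) := {s | ζ :: s ∈ T}

@[simp]
theorem mem_subtree {T : Set (List Λ)} {ζ : Λ} {s : List Λ} : s ∈ subtree T ζ ↔ ζ :: s ∈ T :=
  Iff.rfl

theorem subtree_image_map {Λ' : Type*} {f : Λ → Λ'} (hf : f.Injective) (T : Set (List Λ)) (ζ : Λ) :
    subtree (List.map f '' T) (f ζ) = List.map f '' subtree T ζ := by
  ext s
  constructor
  · rintro ⟨_ | ⟨η, t⟩, ht, h⟩
    · simp at h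
    · obtain ⟨hη, rfl⟩ := List.cons.inj h
      exact ⟨t, hf hη ▸ ht, rfl⟩
  · rintro ⟨t, ht, rfl⟩
    exact ⟨ζ :: t, ht, rfl⟩

theorem nil_mem_maxNodes_iff {T : Set (List Λ)} : [] ∈ maxNodes T ↔ T = {[]} := by
  rw [Set.eq_singleton_iff_unique_mem]
  exact and_congr_right fun _ => forall₂_congr fun _ _ => by simp

theorem cons_mem_maxNodes_iff {T : Set (List Λ)} {ζ : Λ} {t : List Λ} :
    ζ :: t ∈ maxNodes T ↔ t ∈ maxNodes (subtree T ζ) := by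
  refine and_congr_right fun _ => ⟨fun h s hs hts => ?_, fun h s hs => ?_⟩
  · exact (List.cons.inj (h (ζ :: s) hs (List.cons_prefix_cons.2 ⟨rfl, hts⟩))).2
  · rintro ⟨r, rfl⟩
    rw [List.cons_append, h (t ++ r) hs (List.prefix_append t r)]

theorem maxNodes_image_map {Λ' : Type*} {f : Λ → Λ'} (hf : f.Injective) (T : Set (List Λ)) :
    maxNodes (List.map f '' T) = List.map f '' maxNodes T := by
  ext p
  constructor
  · rintro ⟨⟨t, ht, rfl⟩, hmax⟩
    refine ⟨t, ⟨ht, fun s hs hts => ?_⟩, rfl⟩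
    exact List.map_injective_iff.2 hf (hmax _ (Set.mem_image_of_mem _ hs) (hts.map f))
  · rintro ⟨t, ⟨ht, hmax⟩, rfl⟩
    refine ⟨Set.mem_image_of_mem _ ht, ?_⟩
    rintro _ ⟨s, hs, rfl⟩ hts
    rw [hmax s hs ((List.prefix_map_iff_of_injective hf).1 hts)]

theorem mem_maxNodes_treeProd {D : Type*} [Nonempty D] {T : Set (List Λ)} {t : List (Λ × D)} :
    t ∈ maxNodes (treeProd T D) ↔ t.map Prod.fst ∈ maxNodes T := by
  refine and_congr_right fun _ => ⟨fun h => ?_, fun h => ?_⟩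
  · rintro _ hs ⟨r, rfl⟩
    obtain ⟨d⟩ := ‹Nonempty D›
    have hr := h (t ++ r.map fun ζ => (ζ, d)) (by simpa [treeProd, Function.comp_def] using hs)
      (List.prefix_append _ _)
    simpa using hr
  · rintro _ hs ⟨r, rfl⟩
    simpa using h _ hs (by simp)

/-- The tree in which every maximal member of `T₁` is continued by a copy of `T₂`. -/
def concat (T₁ T₂ : Set (List Λ)) : Set (List Λ) :=
  T₁ ∪ Set.image2 (· ++ ·) (maxNodes T₁) T₂

theorem concat_singleton_nil (T : Set (List Λ)) : concat {[]} T = insert [] T := by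
  have h : maxNodes {([] : List Λ)} = {[]} :=
    Set.Subset.antisymm (fun _ ht => ht.1) (Set.singleton_subset_iff.2 (nil_mem_maxNodes_iff.2 rfl))
  rw [concat, h, Set.image2_singleton_left, Set.insert_eq]
  simp

variable {T₁ T₂ : Set (List Λ)} {ζ : Λ}

theorem subtree_concat (h : T₁ ≠ {[]}) : subtree (concat T₁ T₂) ζ = concat (subtree T₁ ζ) T₂ := by
  ext s
  constructor
  · rintro (hs | ⟨_ | ⟨η, t⟩, ht, u, hu, e⟩)
    · exact Or.inl hs
    · exact absurd (nil_mem_maxNodes_iff.1 ht) h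
    · obtain ⟨rfl, rfl⟩ := List.cons.inj e
      exact Or.inr ⟨t, cons_mem_maxNodes_iff.1 ht, u, hu, rfl⟩
  · rintro (hs | ⟨t, ht, u, hu, rfl⟩)
    · exact Or.inl hs
    · exact Or.inr ⟨ζ :: t, cons_mem_maxNodes_iff.2 ht, u, hu, rfl⟩

theorem singleton_mem_concat (h : T₁ ≠ {[]}) : [ζ] ∈ concat T₁ T₂ ↔ [ζ] ∈ T₁ := by
  refine ⟨?_, Or.inl⟩
  rintro (hζ | ⟨_ | ⟨η, t⟩, ht, u, hu, e⟩)
  · exact hζ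
  · exact absurd (nil_mem_maxNodes_iff.1 ht) h
  · obtain ⟨rfl, htu⟩ : η = ζ ∧ t ++ u = [] := List.cons.inj e
    obtain ⟨rfl, rfl⟩ := List.append_eq_nil_iff.1 htu
    exact ht.1

/-- The nonempty initial segments of members of `T` belong to `T`. Trees of nonempty sequences, such
as `Γ_{ξ,n}`, have this property. -/
def PrefixClosed (T : Set (List Λ)) : Prop :=
  ∀ s t, s ≠ [] → s ++ t ∈ T → s ∈ T

theorem PrefixClosed.subtree {T : Set (List Λ)} (h : PrefixClosed T) (ζ : Λ) :
    PrefixClosed (subtree T ζ) :=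
  fun s t _ => h (ζ :: s) t (List.cons_ne_nil ζ s)

theorem PrefixClosed.image_map {Λ' : Type*} {T : Set (List Λ)} (h : PrefixClosed T) (f : Λ → Λ') :
    PrefixClosed (List.map f '' T) := by
  rintro s t hs ⟨r, hr, e⟩
  obtain ⟨r₁, r₂, rfl, rfl, rfl⟩ := List.map_eq_append_iff.1 e
  exact ⟨r₁, h r₁ r₂ (by simpa using hs) hr, rfl⟩

theorem PrefixClosed.concat (h₁ : PrefixClosed T₁) (h₂ : PrefixClosed T₂) :
    PrefixClosed (concat T₁ T₂) := by
  rintro s t hs (hst | ⟨r, hr, u, hu, e⟩)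
  · exact Or.inl (h₁ s t hs hst)
  · rcases List.append_eq_append_iff.1 e.symm with ⟨r', rfl, rfl⟩ | ⟨s', rfl, rfl⟩
    · exact Or.inl (h₁ s r' hs hr.1)
    · rcases eq_or_ne s' [] with rfl | hs'
      · exact Or.inl (by simpa using hr.1)
      · exact Or.inr ⟨r, hr, s', h₂ s' t hs' hu, rfl⟩

theorem PrefixClosed.biUnion {ι : Type*} {P : ι → Prop} {T : ι → Set (List Λ)}
    (h : ∀ i, P i → PrefixClosed (T i)) : PrefixClosed (⋃ i, ⋃ _ : P i, T i) := by
  intro s t hs hst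
  simp only [Set.mem_iUnion] at hst ⊢
  obtain ⟨i, hi, hst⟩ := hst
  exact ⟨i, hi, h i hi s t hs hst⟩

end Trees

section Game

variable {𝕜 : Type w} [RCLike 𝕜] {X : Type u} [NormedAddCommGroup X] [NormedSpace 𝕜 X]

/-! ### Weakly null vectors in the unit ball -/

variable (𝕜 X) in
/-- The trace on the closed unit ball of the filter of weak neighbourhoods of `0`: a net in the
ball is weakly null if and only if it tends to this filter. -/
def weaklyNullFilter : Filter X :=
  Filter.comap (toWeakSpace 𝕜 X) (𝓝 0) ⊓ Filter.principal {x | ‖x‖ ≤ 1}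

theorem tendsto_weaklyNullFilter {α : Type*} {l : Filter α} {f : α → X} :
    Filter.Tendsto f l (weaklyNullFilter 𝕜 X) ↔
      Filter.Tendsto (fun i => toWeakSpace 𝕜 X (f i)) l (𝓝 0) ∧ ∀ᶠ i in l, ‖f i‖ ≤ 1 := by
  simp [weaklyNullFilter, Filter.tendsto_inf, Filter.tendsto_comap_iff, Function.comp_def]

instance weaklyNullFilter_neBot : (weaklyNullFilter 𝕜 X).NeBot := by
  have h : Filter.Tendsto (fun _ : Unit => (0 : X)) ⊤ (weaklyNullFilter 𝕜 X) :=
    tendsto_weaklyNullFilter.2 (by simp)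
  exact h.neBot

theorem tendsto_toWeakSpace_weaklyNullFilter :
    Filter.Tendsto (toWeakSpace 𝕜 X) (weaklyNullFilter 𝕜 X) (𝓝 0) :=
  (tendsto_weaklyNullFilter.1 Filter.tendsto_id).1

theorem eventually_norm_le_one : ∀ᶠ y in weaklyNullFilter 𝕜 X, ‖y‖ ≤ 1 :=
  (tendsto_weaklyNullFilter.1 Filter.tendsto_id).2

theorem tendsto_dual_weaklyNullFilter (f : StrongDual 𝕜 X) :
    Filter.Tendsto f (weaklyNullFilter 𝕜 X) (𝓝 0) := by
  have hf : Continuous fun x : WeakSpace 𝕜 X => f ((toWeakSpace 𝕜 X).symm x) :=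
    WeakBilin.eval_continuous (topDualPairing 𝕜 X).flip f
  simpa [Function.comp_def] using
    (hf.tendsto 0).comp (tendsto_toWeakSpace_weaklyNullFilter (𝕜 := 𝕜) (X := X))

theorem tendsto_contraction_weaklyNullFilter {W : Type*} [NormedAddCommGroup W] [NormedSpace 𝕜 W]
    {C : W →L[𝕜] X} (hC : ‖C‖ ≤ 1) :
    Filter.Tendsto C (weaklyNullFilter 𝕜 W) (weaklyNullFilter 𝕜 X) := by
  refine tendsto_weaklyNullFilter.2 ⟨?_, ?_⟩
  · exact (map_zero (WeakSpace.map C) ▸ (WeakSpace.map C).continuous.tendsto 0).comp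
      (tendsto_toWeakSpace_weaklyNullFilter (𝕜 := 𝕜) (X := W))
  · filter_upwards [eventually_norm_le_one (𝕜 := 𝕜) (X := W)] with y hy
    exact C.unit_le_opNorm y hy |>.trans hC

theorem tendsto_convexCombo_weaklyNullFilter {r s : ℝ} (hr : 0 ≤ r) (hs : 0 ≤ s)
    (h : r + s = 1) :
    Filter.Tendsto (fun q : X × X => (r : 𝕜) • q.1 + (s : 𝕜) • q.2)
      (weaklyNullFilter 𝕜 X ×ˢ weaklyNullFilter 𝕜 X) (weaklyNullFilter 𝕜 X) := by
  have hw := tendsto_toWeakSpace_weaklyNullFilter (𝕜 := 𝕜) (X := X)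
  have hb := eventually_norm_le_one (𝕜 := 𝕜) (X := X)
  refine tendsto_weaklyNullFilter.2 ⟨?_, ?_⟩
  · have hlim := ((hw.comp Filter.tendsto_fst).const_smul (r : 𝕜)).add
      ((hw.comp (Filter.tendsto_snd (f := weaklyNullFilter 𝕜 X))).const_smul (s : 𝕜))
    simpa [Function.comp_def] using hlim
  · filter_upwards [hb.prod_mk hb] with q hq
    calc ‖(r : 𝕜) • q.1 + (s : 𝕜) • q.2‖ ≤ ‖(r : 𝕜) • q.1‖ + ‖(s : 𝕜) • q.2‖ := norm_add_le _ _
      _ = r * ‖q.1‖ + s * ‖q.2‖ := by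
        rw [norm_smul, norm_smul, RCLike.norm_of_nonneg hr, RCLike.norm_of_nonneg hs]
      _ ≤ r * 1 + s * 1 := by gcongr; exacts [hq.1, hq.2]
      _ = 1 := by rw [mul_one, mul_one, h]

/-! ### The game on a weighted tree -/

variable {Λ : Type*} {S : Set X} {T T₁ T₂ : Set (List Λ)} {w w' : List Λ → 𝕜} {z : X}

/-- Two players move along the tree `T`, starting from its root and from the vector `z`. In each
round the first one chooses a letter `ζ` that extends the present node to a node `s` of `T`, and a
set in the filter `weaklyNullFilter`; the second one chooses a vector `y` in this set, and `w s • y`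
is added to the present vector. `Forces S T w z` says that the first player can force the play to
end, and to end in the set `S`. Being inductive, it describes winning strategies as well-founded
trees, and no determinacy theorem is needed: its negation lets the second player survive. -/
inductive Forces (S : Set X) : Set (List Λ) → (List Λ → 𝕜) → X → Prop
  | leaf {T : Set (List Λ)} {w : List Λ → 𝕜} {z : X} (hT : T ⊆ {[]}) (hz : z ∈ S) : Forces S T w z
  | step {T : Set (List Λ)} {w : List Λ → 𝕜} {z : X} (ζ : Λ) (hζ : [ζ] ∈ T) (U : Set X)
      (hU : U ∈ weaklyNullFilter 𝕜 X)
      (h : ∀ y ∈ U, Forces S (subtree T ζ) (fun s => w (ζ :: s)) (z + w [ζ] • y)) :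
      Forces S T w z

theorem Forces.of_eventually (ζ : Λ) (hζ : [ζ] ∈ T) (h : ∀ᶠ y in weaklyNullFilter 𝕜 X,
    Forces S (subtree T ζ) (fun s => w (ζ :: s)) (z + w [ζ] • y)) : Forces S T w z :=
  .step ζ hζ _ h fun _ hy => hy

theorem not_subset_singleton_nil {ζ : Λ} (hζ : [ζ] ∈ T) : ¬ T ⊆ {[]} :=
  fun h => List.cons_ne_nil ζ [] (h hζ)

theorem forces_iff_mem_of_subset (hT : T ⊆ {[]}) : Forces S T w z ↔ z ∈ S := by
  refine ⟨fun h => ?_, .leaf hT⟩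
  cases h with
  | leaf _ hz => exact hz
  | step ζ hζ => exact absurd hT (not_subset_singleton_nil hζ)

theorem Forces.mono {S' : Set X} (hS : S ⊆ S') (h : Forces S T w z) : Forces S' T w z := by
  induction h with
  | leaf hT hz => exact .leaf hT (hS hz)
  | step ζ hζ U hU _ ih => exact .step ζ hζ U hU ih

theorem Forces.of_contraction {W : Type*} [NormedAddCommGroup W] [NormedSpace 𝕜 W]
    {C : W →L[𝕜] X} (hC : ‖C‖ ≤ 1) {z : W} (h : Forces S T w (C z)) :
    Forces (C ⁻¹' S) T w z := by
  generalize hx : C z = x at h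
  induction h generalizing z with
  | leaf hT hz => exact .leaf hT (by rwa [Set.mem_preimage, hx])
  | step ζ hζ U hU _ ih =>
    exact .step ζ hζ _ (tendsto_contraction_weaklyNullFilter hC hU) fun y hy =>
      ih (C y) hy (by simp [hx])

theorem Forces.congr (hw : ∀ s ∈ T, w s = w' s) (h : Forces S T w z) : Forces S T w' z := by
  induction h generalizing w' with
  | leaf hT hz => exact .leaf hT hz
  | step ζ hζ U hU _ ih =>
    exact .step ζ hζ U hU fun y hy => hw [ζ] hζ ▸ ih y hy fun s hs => hw (ζ :: s) hs

theorem forces_congr (hw : ∀ s ∈ T, w s = w' s) : Forces S T w z ↔ Forces S T w' z :=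
  ⟨.congr hw, .congr fun s hs => (hw s hs).symm⟩

theorem forces_image_map {Λ' : Type*} {f : Λ → Λ'} (hf : f.Injective) {w : List Λ' → 𝕜} :
    Forces S (List.map f '' T) w z ↔ Forces S T (fun s => w (s.map f)) z := by
  constructor <;> intro h
  · generalize hT' : List.map f '' T = T' at h
    induction h generalizing T with
    | leaf hT hz =>
      subst hT'
      exact .leaf (fun s hs => by simpa using hT (Set.mem_image_of_mem _ hs)) hz
    | step ζ' hζ U hU _ ih =>
      subst hT'
      obtain ⟨_, ht, e⟩ := hζ
      obtain ⟨ζ, rfl, rfl⟩ := List.map_eq_singleton_iff.1 e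
      exact .step ζ ht U hU fun y hy => ih y hy (subtree_image_map hf T ζ).symm
  · generalize hw : (fun s : List Λ => w (s.map f)) = w' at h
    induction h generalizing w with
    | leaf hT hz =>
      refine .leaf ?_ hz
      rintro _ ⟨s, hs, rfl⟩
      simpa using hT hs
    | step ζ hζ U hU _ ih =>
      subst hw
      refine .step (f ζ) (Set.mem_image_of_mem _ hζ) U hU fun y hy => ?_
      rw [subtree_image_map hf]
      exact ih y hy rfl

theorem forces_biUnion {ι : Type*} {P : ι → Prop} {T : ι → Set (List Λ)} (hP : ∃ i, P i)
    (hT : ∀ i, P i → ¬ T i ⊆ {[]})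
    (hd : ∀ i j ζ s s', P i → P j → ζ :: s ∈ T i → ζ :: s' ∈ T j → i = j) :
    Forces S (⋃ i, ⋃ _ : P i, T i) w z ↔ ∃ i, P i ∧ Forces S (T i) w z := by
  have hsub : ∀ i, P i → ∀ ζ, [ζ] ∈ T i → subtree (⋃ i, ⋃ _ : P i, T i) ζ = subtree (T i) ζ := by
    intro i hi ζ hζ
    ext s
    simp only [mem_subtree, Set.mem_iUnion]
    refine ⟨fun ⟨j, hj, hs⟩ => ?_, fun hs => ⟨i, hi, hs⟩⟩
    rwa [hd i j ζ _ _ hi hj hζ hs]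
  constructor
  · rintro (⟨hsubset, _⟩ | ⟨ζ, hζ, U, hU, h⟩)
    · obtain ⟨i, hi⟩ := hP
      exact absurd ((Set.subset_biUnion_of_mem (u := T) hi).trans hsubset) (hT i hi)
    · simp only [Set.mem_iUnion] at hζ
      obtain ⟨i, hi, hζ⟩ := hζ
      exact ⟨i, hi, .step ζ hζ U hU (hsub i hi ζ hζ ▸ h)⟩
  · rintro ⟨i, hi, ⟨hsubset, _⟩ | ⟨ζ, hζ, U, hU, h⟩⟩
    · exact absurd hsubset (hT i hi)
    · exact .step ζ (Set.mem_biUnion (t := T) hi hζ) U hU ((hsub i hi ζ hζ).symm ▸ h)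

theorem forces_insert_nil : Forces S (insert [] T) w z ↔ Forces S T w z := by
  have hsub : ∀ ζ, subtree (insert [] T) ζ = subtree T ζ := fun ζ => by ext s; simp
  constructor
  · rintro (⟨hT, hz⟩ | ⟨ζ, hζ, U, hU, h⟩)
    · exact .leaf ((Set.subset_insert _ _).trans hT) hz
    · exact .step ζ (by simpa using hζ) U hU (hsub ζ ▸ h)
  · rintro (⟨hT, hz⟩ | ⟨ζ, hζ, U, hU, h⟩)
    · exact .leaf (Set.insert_subset rfl hT) hz
    · exact .step ζ (Set.mem_insert_of_mem _ hζ) U hU ((hsub ζ).symm ▸ h)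

theorem forces_concat_singleton_nil {w₂ : List Λ → 𝕜} (hw : ∀ u ∈ T, w u = w₂ u) :
    Forces S (concat {[]} T) w z ↔ Forces {x | Forces S T w₂ x} {[]} w z := by
  rw [concat_singleton_nil, forces_insert_nil, forces_congr hw,
    forces_iff_mem_of_subset Set.Subset.rfl, Set.mem_ofPred_eq]

theorem forces_concat {w₂ : List Λ → 𝕜} (hne : T₁.Nonempty)
    (hw : ∀ t ∈ maxNodes T₁, ∀ u ∈ T₂, w (t ++ u) = w₂ u) :
    Forces S (concat T₁ T₂) w z ↔ Forces {x | Forces S T₂ w₂ x} T₁ w z := by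
  have hw_subtree : ∀ {T : Set (List Λ)} {w : List Λ → 𝕜} {ζ : Λ},
      (∀ t ∈ maxNodes T, ∀ u ∈ T₂, w (t ++ u) = w₂ u) →
      ∀ t ∈ maxNodes (subtree T ζ), ∀ u ∈ T₂, w (ζ :: (t ++ u)) = w₂ u :=
    fun hw t ht => hw (_ :: t) (cons_mem_maxNodes_iff.2 ht)
  have hnil : ∀ {w : List Λ → 𝕜}, (∀ t ∈ maxNodes {[]}, ∀ u ∈ T₂, w (t ++ u) = w₂ u) →
      ∀ u ∈ T₂, w u = w₂ u := fun hw => hw [] (nil_mem_maxNodes_iff.2 rfl)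
  constructor <;> intro h
  · generalize hT : concat T₁ T₂ = T at h
    induction h generalizing T₁ with
    | leaf hsubset hz =>
      subst hT
      obtain rfl := hne.subset_singleton_iff.1 (Set.subset_union_left.trans hsubset)
      exact (forces_concat_singleton_nil (hnil hw)).1 (.leaf hsubset hz)
    | step ζ hζ U hU h ih =>
      subst hT
      rcases eq_or_ne T₁ {[]} with rfl | hT₁
      · exact (forces_concat_singleton_nil (hnil hw)).1 (.step ζ hζ U hU h)
      · rw [singleton_mem_concat hT₁] at hζ
        exact .step ζ hζ U hU fun y hy => ih y hy ⟨[], hζ⟩ (hw_subtree hw) (subtree_concat hT₁).symm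
  · induction h with
    | leaf hsubset hz =>
      obtain rfl := hne.subset_singleton_iff.1 hsubset
      exact (forces_concat_singleton_nil (hnil hw)).2 (.leaf hsubset hz)
    | @step T₁ w z ζ hζ U hU _ ih =>
      have hT₁ : T₁ ≠ {[]} := fun h => not_subset_singleton_nil hζ h.subset
      refine .step ζ ((singleton_mem_concat hT₁).2 hζ) U hU fun y hy => ?_
      rw [subtree_concat hT₁]
      exact ih y hy ⟨[], hζ⟩ (hw_subtree hw)

/-! ### The game and weakly null collections -/

section PathSum

variable {D R M : Type*} [AddCommMonoid M] [SMul R M]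

/-- The sum of the vectors `w s • x_s` over the nonempty initial segments `s` of `t`, where the
weight `w s` depends only on the first coordinates. The recursion follows the rounds of the game. -/
def pathSum : (List Λ → R) → (List (Λ × D) → M) → List (Λ × D) → M
  | _, _, [] => 0
  | w, x, q :: t => w [q.1] • x [q] + pathSum (fun s => w (q.1 :: s)) (fun s => x (q :: s)) t

theorem pathSum_eq_sum (w : List Λ → R) (x : List (Λ × D) → M) (t : List (Λ × D)) :
    pathSum w x t = ∑ k ∈ Finset.Icc 1 t.length, w ((t.take k).map Prod.fst) • x (t.take k) := by
  have sum_Icc_one (n : ℕ) (f : ℕ → M) :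
      ∑ k ∈ Finset.Icc 1 n, f k = ∑ k ∈ Finset.range n, f (k + 1) := by
    rw [Finset.range_eq_Ico, Finset.sum_Ico_add', zero_add, Finset.Ico_add_one_right_eq_Icc]
  induction t generalizing w x with
  | nil => rfl
  | cons q t ih =>
    rw [pathSum, ih, sum_Icc_one, sum_Icc_one, List.length_cons, Finset.sum_range_succ', add_comm]
    simp

theorem pathSum_congr {w : List Λ → R} {x x' : List (Λ × D) → M} (t : List (Λ × D))
    (h : ∀ s ≠ [], x s = x' s) : pathSum w x t = pathSum w x' t := by
  induction t generalizing w x x' with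
  | nil => rfl
  | cons q t ih =>
    rw [pathSum, pathSum, h [q] (List.cons_ne_nil _ _),
      ih fun s _ => h (q :: s) (List.cons_ne_nil _ _)]

end PathSum

theorem Forces.exists_branch {D : Type*} [Preorder D] [IsDirectedOrder D] [Nonempty D]
    (h : Forces S T w z) (hne : T.Nonempty) {x : List (Λ × D) → X}
    (hx : IsWeaklyNull 𝕜 T x) (hb : ∀ t ∈ treeProd T D, ‖x t‖ ≤ 1) :
    ∃ t : List (Λ × D), t.map Prod.fst ∈ maxNodes T ∧ z + pathSum w x t ∈ S := by
  induction h generalizing x with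
  | leaf hT hz =>
    exact ⟨[], nil_mem_maxNodes_iff.2 (hne.subset_singleton_iff.1 hT), by simpa [pathSum] using hz⟩
  | step ζ hζ U hU _ ih =>
    have hlim : Filter.Tendsto (fun v : D => x [(ζ, v)]) Filter.atTop (weaklyNullFilter 𝕜 X) :=
      tendsto_weaklyNullFilter.2 ⟨hx [] ζ hζ, .of_forall fun v => hb [(ζ, v)] hζ⟩
    obtain ⟨v, hv⟩ := (hlim.eventually_mem hU).exists
    obtain ⟨t, ht, hS⟩ := ih _ hv ⟨[], hζ⟩ (x := fun s => x ((ζ, v) :: s))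
      (fun t => hx ((ζ, v) :: t)) (fun t => hb ((ζ, v) :: t))
    exact ⟨(ζ, v) :: t, cons_mem_maxNodes_iff.2 ht, by simpa [pathSum, add_assoc] using hS⟩

open Classical in
/-- A vector of the unit ball in the weak neighbourhood `q.2`, chosen by the second player in such a
way that the first one cannot win afterwards, if there is such a vector, and `0` otherwise. -/
def reply (S : Set X) (T : Set (List Λ)) (w : List Λ → 𝕜) (z : X) (q : Λ × WeakNhds 𝕜 X) : X :=
  if h : ∃ y, toWeakSpace 𝕜 X y ∈ OrderDual.ofDual q.2 ∧ ‖y‖ ≤ 1 ∧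
    ¬ Forces S (subtree T q.1) (fun s => w (q.1 :: s)) (z + w [q.1] • y) then h.choose else 0

theorem reply_mem (S : Set X) (T : Set (List Λ)) (w : List Λ → 𝕜) (z : X)
    (q : Λ × WeakNhds 𝕜 X) : toWeakSpace 𝕜 X (reply S T w z q) ∈ OrderDual.ofDual q.2 := by
  rw [reply]
  split_ifs with h
  · exact h.choose_spec.1
  · rw [map_zero]
    exact (OrderDual.ofDual q.2).mem

theorem norm_reply_le (S : Set X) (T : Set (List Λ)) (w : List Λ → 𝕜) (z : X)
    (q : Λ × WeakNhds 𝕜 X) : ‖reply S T w z q‖ ≤ 1 := by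
  rw [reply]
  split_ifs with h
  · exact h.choose_spec.2.1
  · simp

theorem not_forces_reply (h : ¬ Forces S T w z) {q : Λ × WeakNhds 𝕜 X} (hq : [q.1] ∈ T) :
    ¬ Forces S (subtree T q.1) (fun s => w (q.1 :: s)) (z + w [q.1] • reply S T w z q) := by
  have hex : ∃ y, toWeakSpace 𝕜 X y ∈ OrderDual.ofDual q.2 ∧ ‖y‖ ≤ 1 ∧
      ¬ Forces S (subtree T q.1) (fun s => w (q.1 :: s)) (z + w [q.1] • y) := by
    by_contra! hn
    refine h (.of_eventually q.1 hq ?_)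
    filter_upwards [tendsto_toWeakSpace_weaklyNullFilter.eventually_mem
      ((OrderDual.ofDual q.2).isOpen.mem_nhds (OrderDual.ofDual q.2).mem),
      eventually_norm_le_one (𝕜 := 𝕜)] with y hmem hnorm
    exact hn y hmem hnorm
  rw [reply, dif_pos hex]
  exact hex.choose_spec.2.2

/-- The collection of all vectors that the second player chooses by the rule `reply`. The value at
the empty sequence is irrelevant. -/
def replies (S : Set X) : Set (List Λ) → (List Λ → 𝕜) → X → List (Λ × WeakNhds 𝕜 X) → X
  | _, _, _, [] => 0
  | T, w, z, [q] => reply S T w z q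
  | T, w, z, q :: q' :: t =>
      replies S (subtree T q.1) (fun s => w (q.1 :: s)) (z + w [q.1] • reply S T w z q) (q' :: t)

theorem replies_cons {q : Λ × WeakNhds 𝕜 X} {t : List (Λ × WeakNhds 𝕜 X)} (ht : t ≠ []) :
    replies S T w z (q :: t) = replies S (subtree T q.1) (fun s => w (q.1 :: s))
      (z + w [q.1] • reply S T w z q) t := by
  cases t with
  | nil => exact absurd rfl ht
  | cons q' t => rfl

theorem norm_replies_le (S : Set X) (T : Set (List Λ)) (w : List Λ → 𝕜) (z : X)
    (t : List (Λ × WeakNhds 𝕜 X)) : ‖replies S T w z t‖ ≤ 1 := by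
  induction t generalizing T w z with
  | nil => simp [replies]
  | cons q t ih =>
    rcases eq_or_ne t [] with rfl | ht
    · exact norm_reply_le S T w z q
    · exact replies_cons ht ▸ ih _ _ _

theorem replies_append_singleton_mem (S : Set X) (T : Set (List Λ)) (w : List Λ → 𝕜) (z : X)
    (t : List (Λ × WeakNhds 𝕜 X)) (q : Λ × WeakNhds 𝕜 X) :
    toWeakSpace 𝕜 X (replies S T w z (t ++ [q])) ∈ OrderDual.ofDual q.2 := by
  induction t generalizing T w z with
  | nil => exact reply_mem S T w z q
  | cons q' t ih =>
    rw [List.cons_append, replies_cons (List.append_ne_nil_of_right_ne_nil t (by simp))]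
    exact ih _ _ _

theorem isWeaklyNull_replies (S : Set X) (T T' : Set (List Λ)) (w : List Λ → 𝕜) (z : X) :
    IsWeaklyNull 𝕜 T' (replies S T w z) := by
  intro t ζ _ V hV
  obtain ⟨V', hV', hopen, hzero⟩ := mem_nhds_iff.1 hV
  let v : TopologicalSpace.OpenNhdsOf (0 : WeakSpace 𝕜 X) := ⟨⟨V', hopen⟩, hzero⟩
  rw [Filter.mem_map]
  filter_upwards [Filter.mem_atTop (OrderDual.toDual v)] with u hu
  exact hV' (hu (replies_append_singleton_mem S T w z t (ζ, u)))

theorem pathSum_replies_notMem (hT : PrefixClosed T) (h : ¬ Forces S T w z)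
    {t : List (Λ × WeakNhds 𝕜 X)} (ht : t.map Prod.fst ∈ maxNodes T) :
    z + pathSum w (replies S T w z) t ∉ S := by
  induction t generalizing T w z with
  | nil =>
    rw [pathSum, add_zero]
    exact mt (Forces.leaf (nil_mem_maxNodes_iff.1 ht).subset) h
  | cons q t ih =>
    have hq : [q.1] ∈ T := hT [q.1] (t.map Prod.fst) (List.cons_ne_nil _ _) ht.1
    rw [pathSum, pathSum_congr t fun s hs => replies_cons hs, ← add_assoc]
    exact ih (hT.subtree q.1) (not_forces_reply h hq) (cons_mem_maxNodes_iff.1 ht)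

end Game

/-! ### The structure of the trees `Γ_{ξ,n}` -/

section Gamma

variable {ξ ζ : Ordinal.{v}} {m n : ℕ} {s t u : List Ordinal.{v}}

theorem mem_graph_weight (h : t ∈ Gam ξ n) : (t, weight ξ n t) ∈ graph ξ n := by
  obtain ⟨⟨t, r⟩, hr, rfl⟩ := h
  rwa [weight_eq hr]

theorem Gam_zero_right (ξ : Ordinal.{v}) : Gam ξ 0 = ∅ := by
  simp [Gam, graph, stackGraph]

theorem Gam_one_nonempty (ξ : Ordinal.{v}) : (Gam ξ 1).Nonempty := by
  induction ξ using Ordinal.limitRecOn with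
  | zero => exact Gam_zero_one ▸ Set.singleton_nonempty _
  | add_one ξ ih =>
    rw [Gam_succ_one]
    exact ih.mono (Set.subset_biUnion_of_mem (u := Gam ξ) (le_refl 1))
  | limit ξ hξ ih =>
    rw [Gam_limit_one ξ hξ]
    exact ((ih (0 + 1) (hξ.add_one_lt hξ.bot_lt)).image _).mono
      (Set.subset_biUnion_of_mem (u := fun ζ => shift (ω ^ ζ) '' Gam (ζ + 1) 1) hξ.bot_lt)

theorem Gam_nonempty (ξ : Ordinal.{v}) (hn : 1 ≤ n) : (Gam ξ n).Nonempty := by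
  obtain ⟨m, rfl⟩ := Nat.exists_eq_add_of_le' hn
  obtain ⟨t, ht⟩ := Gam_one_nonempty ξ
  rw [Gam_add_one]
  exact ⟨_, Or.inl ⟨t, ht, rfl⟩⟩

theorem ne_nil_and_lt_of_mem_Gam (hu : u ∈ Gam ξ n) : u ≠ [] ∧ ∀ b ∈ u, b < ω ^ ξ * n := by
  cases n with
  | zero => simp [Gam_zero_right] at hu
  | succ m =>
    obtain ⟨⟨a, l, rfl, -⟩, hlt⟩ := (good ξ).bound m u hu
    exact ⟨List.cons_ne_nil a l, hlt⟩

theorem not_Gam_subset_singleton_nil (ξ : Ordinal.{v}) (hn : 1 ≤ n) : ¬ Gam ξ n ⊆ {[]} := by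
  obtain ⟨t, ht⟩ := Gam_nonempty ξ hn
  exact fun h => (ne_nil_and_lt_of_mem_Gam ht).1 (h ht)

theorem maxNodes_image_shift (c : Ordinal.{v}) (T : Set (List Ordinal.{v})) :
    maxNodes (shift c '' T) = shift c '' maxNodes T :=
  maxNodes_image_map (add_right_injective c) T

theorem Gam_add_one_eq_concat (ξ : Ordinal.{v}) (n : ℕ) :
    Gam ξ (n + 1) = concat (shift (ω ^ ξ * n) '' Gam ξ 1) (Gam ξ n) := by
  rw [Gam_add_one, concat, maxNodes_image_shift, Set.image2_image_left]
  ext p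
  simp [eq_comm]

/-- The entries of the members of `Γ_{ξ,n+1}` that come before a member of `Γ_{ξ,n}` are at least
`ω ^ ξ * n`, so the first letter determines `n`. -/
theorem le_of_cons_mem_Gam (hs : ζ :: s ∈ Gam ξ m) (ht : ζ :: t ∈ Gam ξ n) : m ≤ n := by
  cases m with
  | zero => exact n.zero_le
  | succ m =>
    obtain ⟨⟨_, _, e, hge⟩, -⟩ := (good ξ).bound m _ hs
    obtain ⟨rfl, rfl⟩ := List.cons.inj e
    have hlt := hge.trans_lt ((ne_nil_and_lt_of_mem_Gam ht).2 ζ (by simp))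
    exact_mod_cast lt_of_mul_lt_mul_left' hlt

theorem le_of_cons_mem_shift_Gam {η η' : Ordinal.{v}}
    (hs : ζ :: s ∈ shift (ω ^ η) '' Gam (η + 1) 1)
    (ht : ζ :: t ∈ shift (ω ^ η') '' Gam (η' + 1) 1) : η ≤ η' := by
  obtain ⟨s', -, hs⟩ := hs
  obtain ⟨t', ht', ht⟩ := ht
  have hge : ω ^ η ≤ ζ := shift_ge (t := s') (by simp [hs])
  obtain ⟨c, hc, rfl⟩ : ∃ c ∈ t', ω ^ η' + c = ζ := by
    simpa [shift] using (by simp [ht] : ζ ∈ shift (ω ^ η') t')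
  have hlt := Ordinal.isPrincipal_add_omega0_opow (η' + 1)
    ((Ordinal.opow_lt_opow_iff_right Ordinal.one_lt_omega0).2 (lt_add_one η'))
    (((good (η' + 1)).1 t' ht').2 c hc)
  exact Order.lt_add_one_iff.1
    ((Ordinal.opow_lt_opow_iff_right Ordinal.one_lt_omega0).1 (hge.trans_lt hlt))

theorem prefixClosed_Gam_of_one (h : PrefixClosed (Gam ξ 1)) (n : ℕ) : PrefixClosed (Gam ξ n) := by
  induction n with
  | zero => simp [PrefixClosed, Gam_zero_right]
  | succ n ih => exact Gam_add_one_eq_concat ξ n ▸ (h.image_map _).concat ih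

theorem prefixClosed_Gam (ξ : Ordinal.{v}) (n : ℕ) : PrefixClosed (Gam ξ n) := by
  refine prefixClosed_Gam_of_one ?_ n
  induction ξ using Ordinal.limitRecOn with
  | zero =>
    rw [Gam_zero_one]
    intro s t hs hst
    exact ((List.append_eq_singleton_iff.1 hst).resolve_left fun h => hs h.1).1
  | add_one ξ ih =>
    rw [Gam_succ_one]
    exact .biUnion fun n _ => prefixClosed_Gam_of_one ih n
  | limit ξ hξ ih =>
    rw [Gam_limit_one ξ hξ]
    exact .biUnion fun ζ hζ => (ih _ (hξ.add_one_lt hζ)).image_map _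

theorem weight_zero_one : weight (0 : Ordinal.{v}) 1 [0] = 1 :=
  weight_eq (graph_zero_one ▸ rfl)

theorem weight_shift (hs : s ∈ Gam ξ 1) :
    weight ξ (n + 1) (shift (ω ^ ξ * n) s) = weight ξ 1 s := by
  refine weight_eq ?_
  rw [graph_add_one]
  exact Or.inl ⟨s, _, mem_graph_weight hs, rfl⟩

theorem weight_append (ht : t ∈ maxNodes (Gam ξ 1)) (hu : u ∈ Gam ξ n) :
    weight ξ (n + 1) (shift (ω ^ ξ * n) t ++ u) = weight ξ n u := by
  refine weight_eq ?_
  rw [graph_add_one]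
  exact Or.inr ⟨t, ht, u, _, mem_graph_weight hu, rfl⟩

theorem weight_succ_one (hn : 1 ≤ n) (ht : t ∈ Gam ξ n) :
    weight (ξ + 1) 1 t = (n : ℝ)⁻¹ * weight ξ n t := by
  refine weight_eq ?_
  rw [graph_succ_one]
  exact ⟨n, hn, t, _, mem_graph_weight ht, rfl⟩

theorem weight_limit_one (hξ : Order.IsSuccLimit ξ) (hζ : ζ < ξ) (ht : t ∈ Gam (ζ + 1) 1) :
    weight ξ 1 (shift (ω ^ ζ) t) = weight (ζ + 1) 1 t := by
  refine weight_eq ?_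
  rw [graph_limit_one ξ hξ]
  exact ⟨ζ, hζ, t, _, mem_graph_weight ht, rfl⟩

theorem level_subset_Gam (ξ : Ordinal.{v}) (n i : ℕ) : level ξ n i ⊆ Gam ξ n := by
  induction n generalizing i with
  | zero => simp [level]
  | succ n ih =>
    rw [Gam_add_one]
    cases i with
    | zero => exact Set.subset_union_left
    | succ i =>
      rintro p ⟨t, ht, u, hu, rfl⟩
      exact Or.inr ⟨t, ht, u, ih i hu, rfl⟩

theorem shift_append_inj (hu : ∀ b ∈ u, b < ω ^ ξ * n) {t' u' : List Ordinal.{v}}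
    (hu' : ∀ b ∈ u', b < ω ^ ξ * n)
    (h : shift (ω ^ ξ * n) t ++ u = shift (ω ^ ξ * n) t' ++ u') : u = u' :=
  (split_unique (fun _ => shift_ge) (fun _ => shift_ge) hu hu' h).2

theorem shift_mem_level_iff {i : ℕ} (hs : s ∈ Gam ξ 1) :
    shift (ω ^ ξ * n) s ∈ level ξ (n + 1) i ↔ i = 0 := by
  cases i with
  | zero => exact iff_of_true ⟨s, hs, rfl⟩ rfl
  | succ i =>
    refine iff_of_false ?_ i.succ_ne_zero
    rintro ⟨t, -, u, hu, e⟩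
    obtain ⟨hne, hlt⟩ := ne_nil_and_lt_of_mem_Gam (level_subset_Gam ξ n i hu)
    exact hne (shift_append_inj (u' := []) hlt (by simp) (by rw [← e, List.append_nil]))

theorem append_notMem_level_zero (hu : u ∈ Gam ξ n) :
    shift (ω ^ ξ * n) t ++ u ∉ level ξ (n + 1) 0 := by
  rintro ⟨s, -, e⟩
  obtain ⟨hne, hlt⟩ := ne_nil_and_lt_of_mem_Gam hu
  exact hne (shift_append_inj (u' := []) hlt (by simp) (by rw [e, List.append_nil]))

theorem append_mem_level_succ_iff {i : ℕ} (ht : t ∈ maxNodes (Gam ξ 1)) (hu : u ∈ Gam ξ n) :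
    shift (ω ^ ξ * n) t ++ u ∈ level ξ (n + 1) (i + 1) ↔ u ∈ level ξ n i := by
  refine ⟨?_, fun h => ⟨t, ht, u, h, rfl⟩⟩
  rintro ⟨t', -, u', hu', e⟩
  rwa [shift_append_inj (ne_nil_and_lt_of_mem_Gam hu).2
    (ne_nil_and_lt_of_mem_Gam (level_subset_Gam ξ n i hu')).2 e]

variable {𝕜 : Type w} [RCLike 𝕜]

open Classical in
/-- The coefficient of `x_s` in the sum `∑ᵢ aᵢ ∑ ℙ_{ξ,n}(s) x_s` of `branchSum`. -/
def branchCoeff (ξ : Ordinal.{v}) (n : ℕ) (a : ℕ → 𝕜) (s : List Ordinal.{v}) : 𝕜 :=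
  (∑ i ∈ Finset.range n, if s ∈ level ξ n i then a i else 0) * (weight ξ n s : ℝ)

theorem branchCoeff_shift (a : ℕ → 𝕜) (hs : s ∈ Gam ξ 1) :
    branchCoeff ξ (n + 1) a (shift (ω ^ ξ * n) s) = a 0 * (weight ξ 1 s : ℝ) := by
  simp [branchCoeff, weight_shift hs, shift_mem_level_iff hs]

theorem branchCoeff_append (a : ℕ → 𝕜) (ht : t ∈ maxNodes (Gam ξ 1)) (hu : u ∈ Gam ξ n) :
    branchCoeff ξ (n + 1) a (shift (ω ^ ξ * n) t ++ u) =
      branchCoeff ξ n (fun i => a (i + 1)) u := by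
  classical
  rw [branchCoeff, branchCoeff, weight_append ht hu, Finset.sum_range_succ',
    if_neg (append_notMem_level_zero hu), add_zero]
  congr 1
  exact Finset.sum_congr rfl fun i _ => if_congr (append_mem_level_succ_iff ht hu) rfl rfl

theorem branchSum_eq_pathSum {X : Type u} [NormedAddCommGroup X] [NormedSpace 𝕜 X]
    (ξ : Ordinal.{v}) (n : ℕ) (a : ℕ →₀ 𝕜) (x : List (Ordinal.{v} × WeakNhds 𝕜 X) → X)
    (t : List (Ordinal.{v} × WeakNhds 𝕜 X)) :
    branchSum ξ n a x t = pathSum (branchCoeff ξ n a) x t := by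
  classical
  rw [pathSum_eq_sum, branchSum]
  simp only [branchCoeff, Finset.sum_mul, Finset.sum_smul, Finset.smul_sum, Finset.sum_filter]
  rw [Finset.sum_comm]
  refine Finset.sum_congr rfl fun k _ => Finset.sum_congr rfl fun i _ => ?_
  split_ifs
  · rw [smul_smul]
  · rw [zero_mul, zero_smul, smul_zero]

end Gamma

section Attractor

variable {𝕜 : Type w} [RCLike 𝕜] {X : Type u} [NormedAddCommGroup X] [NormedSpace 𝕜 X]
  {Λ : Type*} {ξ ζ : Ordinal.{v}} {n : ℕ} {a : 𝕜} {S : Set X} {z : X}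

/-! ### Attractors -/

/-- The set of all vectors from which the first player can force the game on `Γ_{ξ,1}`, with the
weights `a ℙ_{ξ,1}`, to end in `S`. Such a set is called an attractor of `S` in game theory. -/
def attractor (ξ : Ordinal.{v}) (a : 𝕜) (S : Set X) : Set X :=
  {z | Forces S (Gam ξ 1) (fun s => a * (weight ξ 1 s : ℝ)) z}

theorem attractor_mono (ξ : Ordinal.{v}) (a : 𝕜) : Monotone (attractor (X := X) ξ a) :=
  fun _ _ h _ => Forces.mono h

theorem forces_empty {w : List Λ → 𝕜} : Forces S ∅ w z ↔ z ∈ S :=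
  forces_iff_mem_of_subset (Set.empty_subset _)

theorem forces_image_shift {c : Ordinal.{v}} {T : Set (List Ordinal.{v})}
    {w : List Ordinal.{v} → 𝕜} :
    Forces S (shift c '' T) w z ↔ Forces S T (fun s => w (shift c s)) z :=
  forces_image_map (add_right_injective c)

theorem forces_Gam_add_one {w w' : List Ordinal.{v} → 𝕜}
    (h₁ : ∀ s ∈ Gam ξ 1, w (shift (ω ^ ξ * n) s) = a * (weight ξ 1 s : ℝ))
    (h₂ : ∀ t ∈ maxNodes (Gam ξ 1), ∀ u ∈ Gam ξ n, w (shift (ω ^ ξ * n) t ++ u) = w' u) :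
    Forces S (Gam ξ (n + 1)) w z ↔ z ∈ attractor ξ a {x | Forces S (Gam ξ n) w' x} := by
  rw [Gam_add_one_eq_concat, forces_concat (w₂ := w') ((Gam_one_nonempty ξ).image _),
    forces_image_shift, forces_congr h₁]
  · rfl
  · rw [maxNodes_image_shift]
    rintro _ ⟨t, ht, rfl⟩ u hu
    exact h₂ t ht u hu

theorem forces_branchCoeff_add_one {a : ℕ → 𝕜} :
    Forces S (Gam ξ (n + 1)) (branchCoeff ξ (n + 1) a) z ↔
      z ∈ attractor ξ (a 0) {x | Forces S (Gam ξ n) (branchCoeff ξ n fun i => a (i + 1)) x} :=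
  forces_Gam_add_one (fun _ hs => branchCoeff_shift a hs)
    fun _ ht _ hu => branchCoeff_append a ht hu

theorem forces_weight :
    Forces S (Gam ξ n) (fun s => a * (weight ξ n s : ℝ)) z ↔ z ∈ (attractor ξ a)^[n] S := by
  induction n generalizing z with
  | zero => rw [Gam_zero_right, forces_empty, Function.iterate_zero_apply]
  | succ n ih =>
    rw [forces_Gam_add_one (fun s hs => by rw [weight_shift hs])
      (fun t ht u hu => by rw [weight_append ht hu]), Function.iterate_succ_apply']
    simp only [ih, Set.ofPred_mem_eq]

theorem mem_attractor_zero :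
    z ∈ attractor (0 : Ordinal.{v}) a S ↔ ∀ᶠ y in weaklyNullFilter 𝕜 X, z + a • y ∈ S := by
  have hsub : subtree {[0]} 0 ⊆ ({[]} : Set (List Ordinal.{v})) := fun s hs => by simpa using hs
  have hround (y : X) : Forces S (subtree {[0]} 0)
      (fun s => a * (weight (0 : Ordinal.{v}) 1 (0 :: s) : ℝ))
        (z + (a * (weight (0 : Ordinal.{v}) 1 [0] : ℝ)) • y) ↔ z + a • y ∈ S := by
    rw [forces_iff_mem_of_subset hsub, weight_zero_one, RCLike.ofReal_one, mul_one]
  rw [attractor, Set.mem_ofPred_eq, Gam_zero_one]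
  constructor
  · rintro (⟨h, -⟩ | ⟨ζ, hζ, U, hU, h⟩)
    · exact absurd h (not_subset_singleton_nil rfl)
    · obtain rfl : ζ = 0 := by simpa using hζ
      filter_upwards [hU] with y hy using (hround y).1 (h y hy)
  · exact fun h => .of_eventually 0 rfl (h.mono fun y hy => (hround y).2 hy)

theorem mem_attractor_add_one :
    z ∈ attractor (ξ + 1) a S ↔ ∃ n : ℕ, 1 ≤ n ∧ z ∈ (attractor ξ (a / n))^[n] S := by
  rw [attractor, Set.mem_ofPred_eq, Gam_succ_one,
    forces_biUnion ⟨1, le_rfl⟩ (fun _ => not_Gam_subset_singleton_nil ξ)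
      fun _ _ _ _ _ _ _ hs ht => (le_of_cons_mem_Gam hs ht).antisymm (le_of_cons_mem_Gam ht hs)]
  refine exists_congr fun n => and_congr_right fun hn => ?_
  rw [← forces_weight]
  refine forces_congr fun s hs => ?_
  rw [weight_succ_one hn hs]
  push_cast
  ring

theorem mem_attractor_limit (hξ : Order.IsSuccLimit ξ) :
    z ∈ attractor ξ a S ↔ ∃ ζ < ξ, z ∈ attractor (ζ + 1) a S := by
  have hne (ζ : Ordinal.{v}) : ¬ shift (ω ^ ζ) '' Gam (ζ + 1) 1 ⊆ {[]} := by
    obtain ⟨t, ht⟩ := Gam_one_nonempty (ζ + 1)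
    exact fun h => (ne_nil_and_lt_of_mem_Gam ht).1 (List.map_eq_nil_iff.1 (h ⟨t, ht, rfl⟩))
  rw [attractor, Set.mem_ofPred_eq, Gam_limit_one ξ hξ,
    forces_biUnion ⟨0, hξ.bot_lt⟩ (fun ζ _ => hne ζ) fun _ _ _ _ _ _ _ hs ht =>
      (le_of_cons_mem_shift_Gam hs ht).antisymm (le_of_cons_mem_shift_Gam ht hs)]
  refine exists_congr fun ζ => and_congr_right fun hζ => ?_
  rw [forces_image_shift]
  exact forces_congr fun s hs => by rw [weight_limit_one hξ hζ hs]

/-- Convex combinations of weakly null vectors are weakly null, so a round can be split in two. -/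
theorem attractor_zero_add_subset {r s : ℝ} (hr : 0 < r) (hs : 0 ≤ s) (a : 𝕜) (S : Set X) :
    attractor (0 : Ordinal.{v}) (((r + s : ℝ) : 𝕜) * a) S ⊆
      attractor (0 : Ordinal.{v}) (r * a) (attractor (0 : Ordinal.{v}) (s * a) S) := by
  intro z hz
  have hrs : 0 < r + s := by positivity
  have hrs' : ((r + s : ℝ) : 𝕜) ≠ 0 := RCLike.ofReal_ne_zero.2 hrs.ne'
  have hcombo := tendsto_convexCombo_weaklyNullFilter (𝕜 := 𝕜) (X := X) (r := r / (r + s))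
    (s := s / (r + s)) (by positivity) (by positivity) (by field_simp)
  rw [mem_attractor_zero]
  filter_upwards [(hcombo.eventually (mem_attractor_zero.1 hz)).curry] with x hx
  rw [mem_attractor_zero]
  filter_upwards [hx] with y hy
  convert hy using 1
  rw [add_assoc, smul_add, smul_smul, smul_smul, RCLike.ofReal_div, RCLike.ofReal_div,
    mul_right_comm, mul_div_cancel₀ _ hrs', mul_right_comm, mul_div_cancel₀ _ hrs']

theorem attractor_zero_natCast_mul_subset (M : ℕ) (a : 𝕜) (S : Set X) :
    attractor (0 : Ordinal.{v}) (M * a) S ⊆ (attractor (0 : Ordinal.{v}) a)^[M] S := by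
  induction M with
  | zero =>
    intro z hz
    obtain ⟨y, hy⟩ := (mem_attractor_zero.1 hz).exists
    simpa using hy
  | succ M ih =>
    rw [Function.iterate_succ_apply']
    have hsplit := attractor_zero_add_subset one_pos M.cast_nonneg a S
    rw [RCLike.ofReal_one, one_mul, RCLike.ofReal_natCast] at hsplit
    have hcast : ((1 + M : ℝ) : 𝕜) = (M + 1 : ℕ) := by push_cast; ring
    exact hcast ▸ hsplit.trans (attractor_mono 0 a ih)

theorem attractor_natCast_mul_subset (ξ : Ordinal.{v}) (M : ℕ) (a : 𝕜) (S : Set X) :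
    attractor ξ (M * a) S ⊆ (attractor ξ a)^[M] S := by
  induction ξ using Ordinal.limitRecOn generalizing a S with
  | zero => exact attractor_zero_natCast_mul_subset M a S
  | add_one ξ ih =>
    intro z hz
    obtain ⟨N, hN, hz⟩ := mem_attractor_add_one.1 hz
    have hsplit : z ∈ ((attractor ξ (a / N))^[M])^[N] S :=
      (attractor_mono ξ _).iterate_le_of_le (ih (a / N)) N S (mul_div_assoc (M : 𝕜) a N ▸ hz)
    rw [← Function.iterate_mul, mul_comm, Function.iterate_mul] at hsplit
    exact ((attractor_mono ξ _).iterate N).iterate_le_of_le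
      (fun _ _ hx => mem_attractor_add_one.2 ⟨N, hN, hx⟩) M S hsplit
  | limit ξ hξ ih =>
    intro z hz
    obtain ⟨ζ, hζ, hz⟩ := (mem_attractor_limit hξ).1 hz
    exact (attractor_mono _ a).iterate_le_of_le
      (fun _ _ hx => (mem_attractor_limit hξ).2 ⟨ζ, hζ, hx⟩) M S
      (ih (ζ + 1) (hξ.add_one_lt hζ) a S hz)

theorem iterate_attractor_subset (ξ : Ordinal.{v}) (a : 𝕜) (S : Set X) {M : ℕ} (hM : 1 ≤ M)
    (N : ℕ) : (attractor ξ (a / N))^[N] S ⊆ (attractor ξ (a / (M * N : ℕ)))^[M * N] S := by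
  have hM' : (M : 𝕜) ≠ 0 := Nat.cast_ne_zero.2 (Nat.one_le_iff_ne_zero.1 hM)
  have ha : a / N = M * (a / (M * N : ℕ)) := by
    rw [Nat.cast_mul, ← mul_div_assoc, mul_div_mul_left _ _ hM']
  rw [Function.iterate_mul, ha]
  exact (attractor_mono ξ _).iterate_le_of_le (attractor_natCast_mul_subset ξ M _) N S

theorem attractor_subset_of_le (h : ζ ≤ ξ) (a : 𝕜) (S : Set X) :
    attractor ζ a S ⊆ attractor ξ a S := by
  have hsucc (η : Ordinal.{v}) : attractor η a S ⊆ attractor (η + 1) a S := fun z hz =>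
    mem_attractor_add_one.2 ⟨1, le_rfl, by simpa using hz⟩
  induction ξ using Ordinal.limitRecOn with
  | zero => rw [nonpos_iff_eq_zero.1 h]
  | add_one ξ ih =>
    rcases h.lt_or_eq with h | rfl
    · exact (ih (Order.lt_add_one_iff.1 h)).trans (hsucc ξ)
    · rfl
  | limit ξ hξ ih =>
    rcases h.lt_or_eq with h | rfl
    · exact fun z hz => (mem_attractor_limit hξ).2 ⟨ζ, h, hsucc ζ hz⟩
    · rfl

theorem iterate_attractor_inter_subset
    (h : ∀ S T : Set X, attractor ξ a S ∩ attractor ξ a T ⊆ attractor ξ a (S ∩ T))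
    (n : ℕ) (S T : Set X) :
    (attractor ξ a)^[n] S ∩ (attractor ξ a)^[n] T ⊆ (attractor ξ a)^[n] (S ∩ T) := by
  induction n with
  | zero => exact subset_rfl
  | succ n ih =>
    simp only [Function.iterate_succ_apply']
    exact (h _ _).trans (attractor_mono ξ a ih)

theorem attractor_inter_subset (ξ : Ordinal.{v}) (a : 𝕜) (S T : Set X) :
    attractor ξ a S ∩ attractor ξ a T ⊆ attractor ξ a (S ∩ T) := by
  induction ξ using Ordinal.limitRecOn generalizing a S T with
  | zero =>
    rintro z ⟨hS, hT⟩
    exact mem_attractor_zero.2 ((mem_attractor_zero.1 hS).and (mem_attractor_zero.1 hT))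
  | add_one ξ ih =>
    rintro z ⟨hS, hT⟩
    obtain ⟨N, hN, hS⟩ := mem_attractor_add_one.1 hS
    obtain ⟨M, hM, hT⟩ := mem_attractor_add_one.1 hT
    refine mem_attractor_add_one.2 ⟨M * N, Nat.mul_pos hM hN, ?_⟩
    refine iterate_attractor_inter_subset (ih _) _ S T
      ⟨iterate_attractor_subset ξ a S hM N hS, ?_⟩
    rw [mul_comm M N]
    exact iterate_attractor_subset ξ a T hN M hT
  | limit ξ hξ ih =>
    rintro z ⟨hS, hT⟩
    obtain ⟨ζ, hζ, hS⟩ := (mem_attractor_limit hξ).1 hS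
    obtain ⟨η, hη, hT⟩ := (mem_attractor_limit hξ).1 hT
    have hmax : max ζ η < ξ := max_lt hζ hη
    refine (mem_attractor_limit hξ).2 ⟨max ζ η, hmax, ih _ (hξ.add_one_lt hmax) a S T ⟨?_, ?_⟩⟩
    · exact attractor_subset_of_le (by gcongr; exact le_max_left ζ η) a S hS
    · exact attractor_subset_of_le (by gcongr; exact le_max_right ζ η) a T hT

theorem Forces.inter {a : ℕ → 𝕜} {T : Set X} (hS : Forces S (Gam ξ n) (branchCoeff ξ n a) z)
    (hT : Forces T (Gam ξ n) (branchCoeff ξ n a) z) :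
    Forces (S ∩ T) (Gam ξ n) (branchCoeff ξ n a) z := by
  induction n generalizing a z with
  | zero =>
    rw [Gam_zero_right, forces_empty] at *
    exact ⟨hS, hT⟩
  | succ n ih =>
    rw [forces_branchCoeff_add_one] at *
    exact attractor_mono _ _ (fun x hx => ih hx.1 hx.2) (attractor_inter_subset _ _ _ _ ⟨hS, hT⟩)

theorem mem_attractor_of_seminorm_le (g : Seminorm 𝕜 X) {δ : ℝ}
    (hg : ∀ᶠ y in weaklyNullFilter 𝕜 X, g y ≤ δ) (ξ : Ordinal.{v}) (a : 𝕜) {r : ℝ}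
    (hz : g z ≤ r) : z ∈ attractor ξ a {x | g x ≤ r + ‖a‖ * δ} := by
  refine attractor_subset_of_le (zero_le (a := ξ)) a _ (mem_attractor_zero.2 ?_)
  filter_upwards [hg] with y hy
  calc g (z + a • y) ≤ g z + g (a • y) := map_add_le_add g _ _
    _ = g z + ‖a‖ * g y := by rw [map_smul_eq_mul]
    _ ≤ r + ‖a‖ * δ := by gcongr

theorem forces_of_seminorm_le (g : Seminorm 𝕜 X) {δ : ℝ}
    (hg : ∀ᶠ y in weaklyNullFilter 𝕜 X, g y ≤ δ) (ξ : Ordinal.{v}) (n : ℕ) (a : ℕ → 𝕜) {r : ℝ}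
    (hz : g z ≤ r) :
    Forces {x | g x ≤ r + (∑ i ∈ Finset.range n, ‖a i‖) * δ} (Gam ξ n) (branchCoeff ξ n a) z := by
  induction n generalizing a r z with
  | zero => simpa [Gam_zero_right, forces_empty] using hz
  | succ n ih =>
    rw [forces_branchCoeff_add_one]
    refine attractor_mono _ _ (fun x hx => ?_) (mem_attractor_of_seminorm_le g hg ξ (a 0) hz)
    refine (ih (fun i => a (i + 1)) hx).mono fun y (hy : g y ≤ _) => hy.trans_eq ?_
    rw [Finset.sum_range_succ']
    ring

end Attractor

section Seminorm

variable {𝕜 : Type w} [RCLike 𝕜] {W X Y Z : Type u} [NormedAddCommGroup W] [NormedSpace 𝕜 W]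
  [NormedAddCommGroup X] [NormedSpace 𝕜 X] [NormedAddCommGroup Y] [NormedSpace 𝕜 Y]
  [NormedAddCommGroup Z] [NormedSpace 𝕜 Z] {ξ : Ordinal.{v}} {n : ℕ} {A : X →L[𝕜] Y}
  {a : ℕ →₀ 𝕜} {c : ℝ≥0∞}

/-! ### The seminorms `‖·‖_{ξ,A}` as functions of `A` -/

/-- The contribution of the collections on the single tree `Γ_{ξ,n}` to `‖a‖_{ξ,A}`. -/
def treeSeminorm (ξ : Ordinal.{v}) (n : ℕ) (A : X →L[𝕜] Y) (a : ℕ →₀ 𝕜) : ℝ≥0∞ :=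
  ⨆ x ∈ nullCollections 𝕜 ξ n X,
    ⨅ t ∈ maxNodes (treeProd (Gam ξ n) (WeakNhds 𝕜 X)), ‖A (branchSum ξ n a x t)‖ₑ

theorem treeSeminorm_le_seminormOf (ξ : Ordinal.{v}) (hn : 1 ≤ n) (A : X →L[𝕜] Y)
    (a : ℕ →₀ 𝕜) : treeSeminorm ξ n A a ≤ seminormOf ξ A a :=
  le_iSup₂ (f := fun n (_ : 1 ≤ n) => treeSeminorm ξ n A a) n hn

theorem forces_of_treeSeminorm_lt (h : treeSeminorm ξ n A a < c) :
    Forces {x | ‖A x‖ₑ < c} (Gam ξ n) (branchCoeff ξ n a) 0 := by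
  by_contra hforces
  refine h.not_ge (le_iSup₂_of_le (replies {x | ‖A x‖ₑ < c} (Gam ξ n) (branchCoeff ξ n a) 0)
    ⟨isWeaklyNull_replies _ _ _ _ _, fun t _ => norm_replies_le _ _ _ _ t⟩
    (le_iInf₂ fun t ht => ?_))
  have hend := pathSum_replies_notMem (prefixClosed_Gam ξ n) hforces (mem_maxNodes_treeProd.1 ht)
  rw [zero_add, ← branchSum_eq_pathSum] at hend
  exact not_lt.1 hend

theorem treeSeminorm_le_of_forces (hn : 1 ≤ n)
    (h : Forces {x | ‖A x‖ₑ ≤ c} (Gam ξ n) (branchCoeff ξ n a) 0) : treeSeminorm ξ n A a ≤ c := by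
  refine iSup₂_le fun x hx => ?_
  obtain ⟨t, ht, hend⟩ := h.exists_branch (Gam_nonempty ξ hn) hx.1 hx.2
  rw [zero_add, ← branchSum_eq_pathSum] at hend
  exact (iInf₂_le t (mem_maxNodes_treeProd.2 ht)).trans hend

theorem treeSeminorm_add_le (hn : 1 ≤ n) (A B : X →L[𝕜] Y) (a : ℕ →₀ 𝕜) :
    treeSeminorm ξ n (A + B) a ≤ treeSeminorm ξ n A a + treeSeminorm ξ n B a := by
  refine ENNReal.le_of_forall_pos_le_add fun ε hε hlt => ?_
  obtain ⟨hA, hB⟩ := ENNReal.add_lt_top.1 hlt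
  have hε' : (ε / 2 : ℝ≥0∞) ≠ 0 := by simpa using hε.ne'
  have hAB := (forces_of_treeSeminorm_lt (ENNReal.lt_add_right hA.ne hε')).inter
    (forces_of_treeSeminorm_lt (ENNReal.lt_add_right hB.ne hε'))
  calc treeSeminorm ξ n (A + B) a
      ≤ (treeSeminorm ξ n A a + ε / 2) + (treeSeminorm ξ n B a + ε / 2) :=
        treeSeminorm_le_of_forces hn <| hAB.mono fun x hx =>
          (enorm_add_le (A x) (B x)).trans (add_le_add hx.1.le hx.2.le)
    _ = treeSeminorm ξ n A a + treeSeminorm ξ n B a + ε := by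
        rw [add_add_add_comm, ENNReal.add_halves]

theorem seminormOf_add_le (ξ : Ordinal.{v}) (A B : X →L[𝕜] Y) (a : ℕ →₀ 𝕜) :
    seminormOf ξ (A + B) a ≤ seminormOf ξ A a + seminormOf ξ B a :=
  iSup₂_le fun _ hn => (treeSeminorm_add_le hn A B a).trans
    (add_le_add (treeSeminorm_le_seminormOf ξ hn A a) (treeSeminorm_le_seminormOf ξ hn B a))

theorem sum_range_norm_le_sum_support (a : ℕ →₀ 𝕜) (n : ℕ) :
    ∑ i ∈ Finset.range n, ‖a i‖ ≤ ∑ i ∈ a.support, ‖a i‖ := by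
  rw [← Finset.sum_filter_ne_zero]
  refine Finset.sum_le_sum_of_subset_of_nonneg (fun i hi => ?_) fun i _ _ => norm_nonneg _
  simpa using (Finset.mem_filter.1 hi).2

theorem seminormOf_le_of_eventually (ξ : Ordinal.{v}) (a : ℕ →₀ 𝕜) {δ : ℝ}
    (hA : ∀ᶠ y in weaklyNullFilter 𝕜 X, ‖A y‖ ≤ δ) :
    seminormOf ξ A a ≤ ENNReal.ofReal ((∑ i ∈ a.support, ‖a i‖) * δ) := by
  obtain ⟨y, hy⟩ := hA.exists
  have hδ : 0 ≤ δ := (norm_nonneg _).trans hy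
  refine iSup₂_le fun n hn => treeSeminorm_le_of_forces hn ?_
  refine (forces_of_seminorm_le ((normSeminorm 𝕜 Y).comp (A : X →ₗ[𝕜] Y)) hA ξ n a (r := 0)
    (by simp)).mono fun x (hx : ‖A x‖ ≤ 0 + (∑ i ∈ Finset.range n, ‖a i‖) * δ) => ?_
  rw [zero_add] at hx
  rw [Set.mem_ofPred_eq, ← ofReal_norm]
  exact ENNReal.ofReal_le_ofReal
    (hx.trans (mul_le_mul_of_nonneg_right (sum_range_norm_le_sum_support a n) hδ))

theorem seminormOf_le_opENorm (ξ : Ordinal.{v}) (A : X →L[𝕜] Y) (a : ℕ →₀ 𝕜) :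
    seminormOf ξ A a ≤ ENNReal.ofReal (∑ i ∈ a.support, ‖a i‖) * ‖A‖ₑ := by
  rw [← ofReal_norm, ← ENNReal.ofReal_mul (Finset.sum_nonneg fun i _ => norm_nonneg _)]
  exact seminormOf_le_of_eventually ξ a (eventually_norm_le_one.mono A.unit_le_opNorm)

theorem continuous_seminormOf (ξ : Ordinal.{v}) (a : ℕ →₀ 𝕜) :
    Continuous fun A : X →L[𝕜] Y => seminormOf ξ A a := by
  refine continuous_of_le_add_edist (ENNReal.ofReal (∑ i ∈ a.support, ‖a i‖))
    ENNReal.ofReal_ne_top fun A B => ?_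
  calc seminormOf ξ A a = seminormOf ξ (B + (A - B)) a := by rw [add_sub_cancel]
    _ ≤ seminormOf ξ B a + seminormOf ξ (A - B) a := seminormOf_add_le ξ _ _ a
    _ ≤ seminormOf ξ B a + ENNReal.ofReal (∑ i ∈ a.support, ‖a i‖) * edist A B := by
      rw [edist_eq_enorm_sub]
      gcongr
      exact seminormOf_le_opENorm ξ _ a

theorem seminormOf_eq_zero_of_tendsto (ξ : Ordinal.{v}) (a : ℕ →₀ 𝕜)
    (hA : Filter.Tendsto A (weaklyNullFilter 𝕜 X) (𝓝 0)) : seminormOf ξ A a = 0 := by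
  have hbound : Filter.Tendsto (fun δ : ℝ => ENNReal.ofReal ((∑ i ∈ a.support, ‖a i‖) * δ))
      (𝓝[>] 0) (𝓝 0) := by
    have hcont := ENNReal.continuous_ofReal.comp (continuous_const_mul (∑ i ∈ a.support, ‖a i‖))
    simpa [Function.comp_def] using (hcont.tendsto 0).mono_left nhdsWithin_le_nhds
  refine le_antisymm (ge_of_tendsto hbound ?_) zero_le
  filter_upwards [self_mem_nhdsWithin] with δ hδ
  exact seminormOf_le_of_eventually ξ a (hA.norm.eventually_le_const (by simpa using hδ))

theorem seminormOf_zero (ξ : Ordinal.{v}) (a : ℕ →₀ 𝕜) : seminormOf ξ (0 : X →L[𝕜] Y) a = 0 :=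
  seminormOf_eq_zero_of_tendsto ξ a tendsto_const_nhds

theorem seminormOf_smulRight (ξ : Ordinal.{v}) (f : StrongDual 𝕜 X) (y : Y) (a : ℕ →₀ 𝕜) :
    seminormOf ξ (f.smulRight y) a = 0 := by
  have htendsto := (tendsto_dual_weaklyNullFilter f).smul_const y
  rw [zero_smul] at htendsto
  exact seminormOf_eq_zero_of_tendsto ξ a htendsto

theorem seminormOf_le_mul (ξ : Ordinal.{v}) {B : X →L[𝕜] Z} (hc : c ≠ ∞)
    (h : ∀ x, ‖B x‖ₑ ≤ c * ‖A x‖ₑ) (a : ℕ →₀ 𝕜) : seminormOf ξ B a ≤ c * seminormOf ξ A a := by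
  rcases eq_or_ne c 0 with rfl | hc₀
  · obtain rfl : B = 0 := by
      ext x
      simpa using h x
    simp [seminormOf_zero]
  · simp only [seminormOf, ENNReal.mul_iSup, ENNReal.mul_iInf_of_ne hc₀ hc]
    gcongr
    exact h _

theorem seminormOf_comp_contraction_le (ξ : Ordinal.{v}) (A : X →L[𝕜] Y) {C : W →L[𝕜] X}
    (hC : ‖C‖ ≤ 1) (a : ℕ →₀ 𝕜) : seminormOf ξ (A ∘L C) a ≤ seminormOf ξ A a := by
  refine iSup₂_le fun n hn => le_of_forall_gt fun c hc => ?_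
  obtain ⟨d, hd, hdc⟩ := exists_between hc
  have hforces := forces_of_treeSeminorm_lt ((treeSeminorm_le_seminormOf ξ hn A a).trans_lt hd)
  rw [← map_zero C] at hforces
  refine (treeSeminorm_le_of_forces hn ?_).trans_lt hdc
  exact (hforces.of_contraction hC).mono fun x (hx : ‖A (C x)‖ₑ < d) => hx.le

theorem seminormOf_comp_le (ξ : Ordinal.{v}) (A : X →L[𝕜] Y) (C : W →L[𝕜] X) (a : ℕ →₀ 𝕜) :
    seminormOf ξ (A ∘L C) a ≤ seminormOf ξ A a * ‖C‖ₑ := by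
  rcases eq_or_ne C 0 with rfl | hC
  · simp [seminormOf_zero]
  set C' : W →L[𝕜] X := (‖C‖⁻¹ : 𝕜) • C with hC'
  have hnorm : ‖C'‖ ≤ 1 := (norm_smul_inv_norm hC).le
  have hscale : C = (‖C‖ : 𝕜) • C' := by
    rw [hC', smul_inv_smul₀ (RCLike.ofReal_ne_zero.2 (norm_ne_zero_iff.2 hC))]
  have henorm : ‖(‖C‖ : 𝕜)‖ₑ = ‖C‖ₑ := by
    rw [← ofReal_norm, ← ofReal_norm, RCLike.norm_ofReal, abs_norm]
  calc seminormOf ξ (A ∘L C) a ≤ ‖C‖ₑ * seminormOf ξ (A ∘L C') a := by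
        refine seminormOf_le_mul ξ enorm_ne_top (fun x => ?_) a
        conv_lhs => rw [hscale]
        simp [enorm_smul, henorm]
    _ ≤ ‖C‖ₑ * seminormOf ξ A a := by
        gcongr
        exact seminormOf_comp_contraction_le ξ A hnorm a
    _ = seminormOf ξ A a * ‖C‖ₑ := mul_comm _ _

theorem seminormOf_comp_comp_le (ξ : Ordinal.{v}) (C : W →L[𝕜] X) (A : X →L[𝕜] Y)
    (B : Y →L[𝕜] Z) (a : ℕ →₀ 𝕜) :
    seminormOf ξ (B ∘L A ∘L C) a ≤ ‖B‖ₑ * seminormOf ξ A a * ‖C‖ₑ := by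
  calc seminormOf ξ (B ∘L A ∘L C) a ≤ ‖B‖ₑ * seminormOf ξ (A ∘L C) a :=
        seminormOf_le_mul ξ enorm_ne_top (fun x => B.le_opENorm (A (C x))) a
    _ ≤ ‖B‖ₑ * (seminormOf ξ A a * ‖C‖ₑ) := by
        gcongr
        exact seminormOf_comp_le ξ A C a
    _ = ‖B‖ₑ * seminormOf ξ A a * ‖C‖ₑ := (mul_assoc _ _ _).symm

end Seminorm

section OperatorGauge

/-! ### Banach ideals from lower semicontinuous gauges -/

/-- An extended nonnegative number attached to every operator between Banach spaces; the class of
operators on which it is finite plays the role of `𝔑_{ξ,p}`. -/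
abbrev OperatorGauge (𝕜 : Type w) [RCLike 𝕜] :=
  ∀ (X Y : Type u) [NormedAddCommGroup X] [NormedSpace 𝕜 X] [CompleteSpace X]
    [NormedAddCommGroup Y] [NormedSpace 𝕜 Y] [CompleteSpace Y], (X →L[𝕜] Y) → ℝ≥0∞

/-- Gauges `φ` for which `{A | φ A < ∞}`, normed by `‖A‖ + φ A`, is a Banach ideal: ideal
seminorms with values in `[0, ∞]` that vanish on operators of rank one and are lower semicontinuous
for the operator norm. Homogeneity is not listed since it follows from `comp_le`. -/
structure IsIdealGauge {𝕜 : Type w} [RCLike 𝕜] (φ : OperatorGauge.{u} 𝕜) : Prop where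
  smulRight_eq_zero : ∀ (X Y : Type u) [NormedAddCommGroup X] [NormedSpace 𝕜 X] [CompleteSpace X]
    [NormedAddCommGroup Y] [NormedSpace 𝕜 Y] [CompleteSpace Y] (f : StrongDual 𝕜 X) (y : Y),
    φ X Y (f.smulRight y) = 0
  add_le : ∀ (X Y : Type u) [NormedAddCommGroup X] [NormedSpace 𝕜 X] [CompleteSpace X]
    [NormedAddCommGroup Y] [NormedSpace 𝕜 Y] [CompleteSpace Y] (A B : X →L[𝕜] Y),
    φ X Y (A + B) ≤ φ X Y A + φ X Y B
  comp_le : ∀ (W X Y Z : Type u) [NormedAddCommGroup W] [NormedSpace 𝕜 W] [CompleteSpace W]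
    [NormedAddCommGroup X] [NormedSpace 𝕜 X] [CompleteSpace X]
    [NormedAddCommGroup Y] [NormedSpace 𝕜 Y] [CompleteSpace Y]
    [NormedAddCommGroup Z] [NormedSpace 𝕜 Z] [CompleteSpace Z]
    (C : W →L[𝕜] X) (A : X →L[𝕜] Y) (B : Y →L[𝕜] Z),
    φ W Z (B ∘L A ∘L C) ≤ ‖B‖ₑ * φ X Y A * ‖C‖ₑ
  lowerSemicontinuous : ∀ (X Y : Type u) [NormedAddCommGroup X] [NormedSpace 𝕜 X]
    [CompleteSpace X] [NormedAddCommGroup Y] [NormedSpace 𝕜 Y] [CompleteSpace Y],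
    LowerSemicontinuous (φ X Y)

variable {𝕜 : Type w} [RCLike 𝕜]

theorem isIdealGauge_seminormOf (ξ : Ordinal.{v}) (a : ℕ →₀ 𝕜) :
    IsIdealGauge.{u} fun X Y _ _ _ _ _ _ (A : X →L[𝕜] Y) => seminormOf ξ A a where
  smulRight_eq_zero _ _ _ _ _ _ _ _ f y := seminormOf_smulRight ξ f y a
  add_le _ _ _ _ _ _ _ _ A B := seminormOf_add_le ξ A B a
  comp_le _ _ _ _ _ _ _ _ _ _ _ _ _ _ _ _ C A B := seminormOf_comp_comp_le ξ C A B a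
  lowerSemicontinuous _ _ _ _ _ _ _ _ := (continuous_seminormOf ξ a).lowerSemicontinuous

theorem lowerSemicontinuous_const_mul {α : Type*} [TopologicalSpace α] {f : α → ℝ≥0∞}
    (hf : LowerSemicontinuous f) (c : ℝ≥0∞) : LowerSemicontinuous fun x => c * f x := by
  have hfinite {c : ℝ≥0∞} (hc : c ≠ ∞) : LowerSemicontinuous fun x => c * f x :=
    (ENNReal.continuous_const_mul hc).comp_lowerSemicontinuous hf fun _ _ h =>
      mul_le_mul_right h c
  rcases eq_or_ne c ∞ with rfl | hc
  · simp only [← ENNReal.iSup_natCast, ENNReal.iSup_mul]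
    exact lowerSemicontinuous_iSup fun n => hfinite (ENNReal.natCast_ne_top n)
  · exact hfinite hc

namespace IsIdealGauge

variable {φ : OperatorGauge.{u} 𝕜}

theorem const_mul (hφ : IsIdealGauge φ) (c : ℝ≥0∞) :
    IsIdealGauge fun X Y _ _ _ _ _ _ A => c * φ X Y A where
  smulRight_eq_zero X Y _ _ _ _ _ _ f y := by simp [hφ.smulRight_eq_zero]
  add_le X Y _ _ _ _ _ _ A B := by
    rw [← mul_add]
    gcongr
    exact hφ.add_le X Y A B
  comp_le W X Y Z _ _ _ _ _ _ _ _ _ _ _ _ C A B := by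
    rw [mul_left_comm, mul_assoc c]
    gcongr
    exact hφ.comp_le W X Y Z C A B
  lowerSemicontinuous X Y _ _ _ _ _ _ :=
    lowerSemicontinuous_const_mul (hφ.lowerSemicontinuous X Y) c

theorem iSup {ι : Sort*} {φ : ι → OperatorGauge.{u} 𝕜} (hφ : ∀ i, IsIdealGauge (φ i)) :
    IsIdealGauge fun X Y _ _ _ _ _ _ A => ⨆ i, φ i X Y A where
  smulRight_eq_zero X Y _ _ _ _ _ _ f y := by simp [(hφ _).smulRight_eq_zero]
  add_le X Y _ _ _ _ _ _ A B := iSup_le fun i =>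
    ((hφ i).add_le X Y A B).trans
      (add_le_add (le_iSup (fun i => φ i X Y A) i) (le_iSup (fun i => φ i X Y B) i))
  comp_le W X Y Z _ _ _ _ _ _ _ _ _ _ _ _ C A B := by
    simp only [ENNReal.mul_iSup, ENNReal.iSup_mul]
    exact iSup_mono fun i => (hφ i).comp_le W X Y Z C A B
  lowerSemicontinuous X Y _ _ _ _ _ _ :=
    lowerSemicontinuous_iSup fun i => (hφ i).lowerSemicontinuous X Y

section Finiteness

variable {W X Y Z : Type u} [NormedAddCommGroup W] [NormedSpace 𝕜 W] [CompleteSpace W]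
  [NormedAddCommGroup X] [NormedSpace 𝕜 X] [CompleteSpace X] [NormedAddCommGroup Y]
  [NormedSpace 𝕜 Y] [CompleteSpace Y] [NormedAddCommGroup Z] [NormedSpace 𝕜 Z] [CompleteSpace Z]
  {A B : X →L[𝕜] Y}

theorem smul_le (hφ : IsIdealGauge φ) (c : 𝕜) (A : X →L[𝕜] Y) : φ X Y (c • A) ≤ ‖c‖ₑ * φ X Y A := by
  have hid (E : Type u) [NormedAddCommGroup E] [NormedSpace 𝕜 E] :
      ‖ContinuousLinearMap.id 𝕜 E‖ₑ ≤ 1 := by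
    simpa [← ofReal_norm] using ContinuousLinearMap.norm_id_le (𝕜 := 𝕜) (E := E)
  have hsmul : ‖c • ContinuousLinearMap.id 𝕜 Y‖ₑ ≤ ‖c‖ₑ :=
    (enorm_smul c _).trans_le (mul_le_of_le_one_right zero_le (hid Y))
  calc φ X Y (c • A)
      = φ X Y ((c • ContinuousLinearMap.id 𝕜 Y) ∘L A ∘L ContinuousLinearMap.id 𝕜 X) := by
        congr 1
    _ ≤ ‖c • ContinuousLinearMap.id 𝕜 Y‖ₑ * φ X Y A * ‖ContinuousLinearMap.id 𝕜 X‖ₑ :=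
        hφ.comp_le X X Y Y _ _ _
    _ ≤ ‖c‖ₑ * φ X Y A * 1 := by
        gcongr
        exact hid X
    _ = ‖c‖ₑ * φ X Y A := mul_one _

theorem apply_zero (hφ : IsIdealGauge φ) : φ X Y 0 = 0 := by
  simpa using hφ.smulRight_eq_zero X Y 0 0

theorem smul_eq (hφ : IsIdealGauge φ) (c : 𝕜) (A : X →L[𝕜] Y) : φ X Y (c • A) = ‖c‖ₑ * φ X Y A := by
  refine (hφ.smul_le c A).antisymm ?_
  rcases eq_or_ne c 0 with rfl | hc
  · simp
  calc ‖c‖ₑ * φ X Y A = ‖c‖ₑ * φ X Y (c⁻¹ • c • A) := by rw [inv_smul_smul₀ hc]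
    _ ≤ ‖c‖ₑ * (‖c⁻¹‖ₑ * φ X Y (c • A)) := by
        gcongr
        exact hφ.smul_le _ _
    _ = φ X Y (c • A) := by
        rw [enorm_inv hc, ENNReal.mul_inv_cancel_left (enorm_ne_zero.2 hc) enorm_ne_top]

theorem add_lt_top (hφ : IsIdealGauge φ) (hA : φ X Y A < ∞) (hB : φ X Y B < ∞) :
    φ X Y (A + B) < ∞ :=
  (hφ.add_le X Y A B).trans_lt (ENNReal.add_lt_top.2 ⟨hA, hB⟩)

theorem smul_lt_top (hφ : IsIdealGauge φ) (c : 𝕜) (hA : φ X Y A < ∞) : φ X Y (c • A) < ∞ :=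
  (hφ.smul_le c A).trans_lt (ENNReal.mul_lt_top enorm_lt_top hA)

theorem sub_lt_top (hφ : IsIdealGauge φ) (hA : φ X Y A < ∞) (hB : φ X Y B < ∞) :
    φ X Y (A - B) < ∞ := by
  rw [sub_eq_add_neg, ← neg_one_smul 𝕜 B]
  exact hφ.add_lt_top hA (hφ.smul_lt_top _ hB)

theorem comp_lt_top (hφ : IsIdealGauge φ) (C : W →L[𝕜] X) (B : Y →L[𝕜] Z) (hA : φ X Y A < ∞) :
    φ W Z (B ∘L A ∘L C) < ∞ :=
  (hφ.comp_le W X Y Z C A B).trans_lt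
    (ENNReal.mul_lt_top (ENNReal.mul_lt_top enorm_lt_top hA) enorm_lt_top)

theorem sub_le_of_tendsto (hφ : IsIdealGauge φ) {A : ℕ → X →L[𝕜] Y}
    (hA : Filter.Tendsto A Filter.atTop (𝓝 B)) (C : X →L[𝕜] Y) {c : ℝ≥0∞}
    (hc : ∀ᶠ m in Filter.atTop, φ X Y (C - A m) ≤ c) :
    φ X Y (C - B) ≤ c :=
  ((hφ.lowerSemicontinuous X Y).isClosed_preimage c).mem_of_tendsto (hA.const_sub C) hc

end Finiteness

theorem isOperatorIdeal (hφ : IsIdealGauge φ) :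
    IsOperatorIdeal fun X Y _ _ _ _ _ _ => {A | φ X Y A < ∞} where
  rank_one_mem X Y _ _ _ _ _ _ f y := by simp [hφ.smulRight_eq_zero]
  add_mem _ _ _ _ _ _ _ _ _ _ hA hB := hφ.add_lt_top hA hB
  smul_mem _ _ _ _ _ _ _ _ c _ hA := hφ.smul_lt_top c hA
  comp_mem _ _ _ _ _ _ _ _ _ _ _ _ _ _ _ _ C _ B hA := hφ.comp_lt_top C B hA

theorem isIdealNorm (hφ : IsIdealGauge φ) :
    IsIdealNorm (fun X Y _ _ _ _ _ _ => {A | φ X Y A < ∞})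
      fun X Y _ _ _ _ _ _ A => ‖A‖ + (φ X Y A).toReal where
  nonneg _ _ _ _ _ _ _ _ A _ := add_nonneg (norm_nonneg A) ENNReal.toReal_nonneg
  eq_zero_iff X Y _ _ _ _ _ _ A _ := by
    rw [add_eq_zero_iff_of_nonneg (norm_nonneg A) ENNReal.toReal_nonneg, norm_eq_zero,
      and_iff_left_of_imp]
    rintro rfl
    rw [hφ.apply_zero, ENNReal.toReal_zero]
  add_le X Y _ _ _ _ _ _ A B hA hB := by
    have hgauge := ENNReal.toReal_mono (ENNReal.add_lt_top.2 ⟨hA, hB⟩).ne (hφ.add_le X Y A B)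
    rw [ENNReal.toReal_add (ne_of_lt hA) (ne_of_lt hB)] at hgauge
    linarith [norm_add_le A B]
  smul_eq X Y _ _ _ _ _ _ c A _ := by
    rw [norm_smul, hφ.smul_eq, ENNReal.toReal_mul, toReal_enorm, mul_add]
  rank_one X Y _ _ _ _ _ _ f y := by simp [hφ.smulRight_eq_zero]
  comp_le W X Y Z _ _ _ _ _ _ _ _ _ _ _ _ C A B hA := by
    have hnorm : ‖B ∘L A ∘L C‖ ≤ ‖B‖ * (‖A‖ * ‖C‖) :=
      (B.opNorm_comp_le _).trans (by gcongr; exact A.opNorm_comp_le C)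
    have hgauge := ENNReal.toReal_mono
      (ENNReal.mul_lt_top (ENNReal.mul_lt_top enorm_lt_top hA) enorm_lt_top).ne
      (hφ.comp_le W X Y Z C A B)
    simp only [ENNReal.toReal_mul, toReal_enorm] at hgauge
    linarith

theorem exists_tendsto (hφ : IsIdealGauge φ) {X Y : Type u} [NormedAddCommGroup X]
    [NormedSpace 𝕜 X] [CompleteSpace X] [NormedAddCommGroup Y] [NormedSpace 𝕜 Y]
    [CompleteSpace Y] {A : ℕ → X →L[𝕜] Y}
    (hA : ∀ n, φ X Y (A n) < ∞) (hcauchy : ∀ ε : ℝ, 0 < ε →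
      ∃ N, ∀ m ≥ N, ∀ n ≥ N, ‖A m - A n‖ + (φ X Y (A m - A n)).toReal < ε) :
    ∃ B, Filter.Tendsto A Filter.atTop (𝓝 B) ∧
      Filter.Tendsto (fun n => φ X Y (A n - B)) Filter.atTop (𝓝 0) := by
  have hcauchySeq : CauchySeq A := by
    refine Metric.cauchySeq_iff.2 fun ε hε => ?_
    obtain ⟨N, hN⟩ := hcauchy ε hε
    refine ⟨N, fun m hm n hn => (dist_eq_norm (A m) (A n)).trans_lt ?_⟩
    exact (le_add_of_nonneg_right ENNReal.toReal_nonneg).trans_lt (hN m hm n hn)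
  obtain ⟨B, hB⟩ := cauchySeq_tendsto_of_complete hcauchySeq
  refine ⟨B, hB, ENNReal.tendsto_atTop_zero.2 fun ε hε => ?_⟩
  obtain ⟨δ, -, hδ, hδε⟩ := ENNReal.lt_iff_exists_real_btwn.1 hε
  obtain ⟨N, hN⟩ := hcauchy δ (ENNReal.ofReal_pos.1 hδ)
  refine ⟨N, fun n hn => (hφ.sub_le_of_tendsto hB (A n) ?_).trans hδε.le⟩
  filter_upwards [Filter.eventually_ge_atTop N] with m hm
  refine ENNReal.le_ofReal_iff_toReal_le (hφ.sub_lt_top (hA n) (hA m)).ne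
    (ENNReal.ofReal_pos.1 hδ).le |>.2 ?_
  exact (le_add_of_nonneg_left (norm_nonneg (A n - A m))).trans (hN n hn m hm).le

theorem isBanachIdeal (hφ : IsIdealGauge φ) :
    IsBanachIdeal (fun X Y _ _ _ _ _ _ => {A | φ X Y A < ∞})
      fun X Y _ _ _ _ _ _ A => ‖A‖ + (φ X Y A).toReal where
  ideal := hφ.isOperatorIdeal
  norm := hφ.isIdealNorm
  complete X Y _ _ _ _ _ _ A hA hcauchy := by
    obtain ⟨B, hB, hgauge⟩ := hφ.exists_tendsto hA hcauchy
    obtain ⟨n, hn⟩ := (hgauge.eventually_lt_const ENNReal.zero_lt_top).exists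
    refine ⟨B, by simpa using hφ.sub_lt_top (hA n) hn, ?_⟩
    simpa using (tendsto_iff_norm_sub_tendsto_zero.1 hB).add
      ((ENNReal.tendsto_toReal ENNReal.zero_ne_top).comp hgauge)

end IsIdealGauge

end OperatorGauge

end SzlenkIdeal

end

theorem mainTheorem8_general (𝕜 : Type w) [RCLike 𝕜] (ξ : Ordinal.{v}) {ι : Type*}
    (c : ι → ℝ≥0∞) (a : ι → ℕ →₀ 𝕜) :
    SzlenkIdeal.IsBanachIdeal.{u, w}
      (fun X Y _ _ _ _ _ _ =>
        {A : X →L[𝕜] Y | (⨆ i, c i * SzlenkIdeal.seminormOf ξ A (a i)) < ∞})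
      (fun _ _ _ _ _ _ _ _ A => ‖A‖ + (⨆ i, c i * SzlenkIdeal.seminormOf ξ A (a i)).toReal) :=
  (SzlenkIdeal.IsIdealGauge.iSup fun i =>
    (SzlenkIdeal.isIdealGauge_seminormOf ξ (a i)).const_mul (c i)).isBanachIdeal

theorem mainTheorem8 (𝕜 : Type w) [RCLike 𝕜] (ξ : Ordinal.{v}) (p : ℝ≥0∞) (hp : 1 < p) :
    SzlenkIdeal.IsBanachIdeal.{u, w}
      (fun X Y _ _ _ _ _ _ => SzlenkIdeal.classN 𝕜 ξ p X Y)
      (fun X Y _ _ _ _ _ _ => SzlenkIdeal.normN (𝕜 := 𝕜) (X := X) (Y := Y) ξ p) := by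
  have h := mainTheorem8_general.{u, v, w} 𝕜 ξ (ι := {n : ℕ // 1 ≤ n})
    (fun n => (n : ℝ≥0∞) ^ (p.conjExponent⁻¹).toReal)
    fun n => (n : 𝕜)⁻¹ • ∑ i ∈ Finset.range n, Finsupp.single i 1
  simp only [iSup_subtype] at h
  exact h
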